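/- **Setting.** For a finite set $S\subset\mathbb{R}^2$, a $j$-edge of $S$ is an oriented segment $\overrightarrow{pq}$ with distinct endpoints $p,q\in S$ such that exactly $j$ points of $S$ lie in the open half-plane to the right of the line $pq$ (oriented from $p$ to $q$). Let $e_j(S)$ be the number of $j$-edges of $S$ and $E_k(S)=\sum_{j=0}^{k}e_j(S)$ the number of $(\le k)$-edges. Let $n=12m$ with $m\ge 1$. Consider point sets $S$ of the following kind. $S$ is the union of three chains of $4m=n/3$ points each; the three chains are the images of one of them under the rotations by $0^\circ,120^\circ,240^\circ$ about a point $o$. "The next chain" of a chain is its image under the counterclockwise rotation by $120^\circ$, and the third one is "the remaining chain". The points of each chain are listed from the outermost to the innermost, with strictly decreasing distance to $o$, and the first one is a vertex of the convex hull of $S$. In each chain the first $2m=\frac{2n}{12}$ points form subchain $A$, the next $m=\frac{n}{12}$ points subchain $B$, and the last $m=\frac{n}{12}$ points subchain $C$. A line spanned by two points of a chain is oriented from the outer to the inner point. For each chain: * $A\cup B$ is convex to the right (traversed inwards, it turns right at every triple of points), and $C$ is convex to the left (it turns left at every triple of points); * every line spanned by two points of $A\cup B$ leaves the next chain strictly to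 its right, and the subchain $C$ of its own chain and the whole remaining chain strictly to its left; * every line spanned by two points of $C$ leaves $A$ strictly to its left and $B$ strictly to its right (so it separates them), and leaves the other two subchains of type $C$ strictly to its right; * every line spanned by a point $c$ of $C$ and a point $d$ of the subchain of type $C$ of the remaining chain, oriented from $c$ to $d$, also separates $A$ (strictly on its left) from $B$ (strictly on its right), where $A,B$ are the subchains of the chain of $c$; * the triangle formed by the innermost points of the three subchains of type $B$ contains all three subchains of type $C$ in its interior. **Theorem.** For every $m\ge 1$ such configurations exist. Each such configuration $S$ has exactly $n=12m$ points, and for every integer $k$ with $\lfloor n/3\rfloor\le k\le\lfloor 5n/12\rfloor-1$, $$E_k(S)=3\binom{k+2}{2}+3\binom{k-\frac n3+2}{2},$$ and this number equals $$3\binom{k+2}{2}+\sum_{j=\lfloor n/3\rfloor}^{k}(3j-n+3),$$ which is the lower bound for $E_k$ of $n$-point sets stated by Aichholzer, García, Orden and Ramos. -/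

import Mathlib

/-- The Euclidean plane. -/
abbrev Plane : Type := EuclideanSpace ℝ (Fin 2)

/-- Twice the signed area of the triangle `p q r`. -/
def area2 (p q r : Plane) : ℝ :=
  (q 0 - p 0) * (r 1 - p 1) - (q 1 - p 1) * (r 0 - p 0)

/-- `r` lies in the open half plane to the left of the line `pq` oriented from `p` to `q`. -/
def IsLeft (p q r : Plane) : Prop := 0 < area2 p q r

/-- `r` lies in the open half plane to the right of the line `pq` oriented from `p` to `q`. -/
def IsRight (p q r : Plane) : Prop := area2 p q r < 0

open Classical in
/-- The `j`-edges of a finite set `S`: the oriented segments with distinct endpoints in `S` that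
have exactly `j` points of `S` in the open half plane to their right. -/
noncomputable def edgesOf (S : Finset Plane) (j : ℕ) : Finset (Plane × Plane) :=
  (S ×ˢ S).filter fun e => e.1 ≠ e.2 ∧ (S.filter fun r => IsRight e.1 e.2 r).card = j

/-- `E_k(S) = ∑_{j ≤ k} e_j(S)`, the number of `(≤ k)`-edges of `S`. -/
noncomputable def numLeEdges (S : Finset Plane) (k : ℕ) : ℕ :=
  ∑ j ∈ Finset.range (k + 1), (edgesOf S j).card

/-- The counterclockwise rotation by `120` degrees about the point `o`. -/
noncomputable def rot120 (o x : Plane) : Plane :=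
  !₂[o 0 + (-(x 0 - o 0) - √3 * (x 1 - o 1)) / 2,
     o 1 + (√3 * (x 0 - o 0) - (x 1 - o 1)) / 2]

open Classical in
/-- The set of all points of three chains `P 0`, `P 1`, `P 2` of `4 * m` points each. -/
noncomputable def pointSet {m : ℕ} (P : Fin 3 → Fin (4 * m) → Plane) : Finset Plane :=
  Finset.univ.image fun x : Fin 3 × Fin (4 * m) => P x.1 x.2

/-- Positions of the subchain `A` in a chain: the first `2 * m` points. -/
def InA {m : ℕ} (i : Fin (4 * m)) : Prop := (i : ℕ) < 2 * m

/-- Positions of the subchain `B` in a chain: the next `m` points. -/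
def InB {m : ℕ} (i : Fin (4 * m)) : Prop := 2 * m ≤ (i : ℕ) ∧ (i : ℕ) < 3 * m

/-- Positions of the union `A ∪ B` in a chain. -/
def InAB {m : ℕ} (i : Fin (4 * m)) : Prop := (i : ℕ) < 3 * m

/-- Positions of the subchain `C` in a chain: the last `m` points. -/
def InC {m : ℕ} (i : Fin (4 * m)) : Prop := 3 * m ≤ (i : ℕ)

/-- Three rotationally symmetric chains of `4 * m` points, built from subchains `A`, `B`, `C` of
`2 * m`, `m` and `m` points. `P t i` is the `(i + 1)`-th point of chain `t`, counted from the
outermost one; chain `t + 1` is the next chain after `t` in counterclockwise order, and chain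
`t + 2` is the remaining one. -/
structure IsThreeChainConfig (m : ℕ) (o : Plane) (P : Fin 3 → Fin (4 * m) → Plane) : Prop where
  /-- The chains are the images of each other under the rotation by 120 degrees about `o`. -/
  symmetric : ∀ t i, P (t + 1) i = rot120 o (P t i)
  /-- Every chain starts at a vertex of the convex hull. -/
  hull_vertex : ∀ (t : Fin 3) (i : Fin (4 * m)), (i : ℕ) = 0 →
    P t i ∈ (convexHull ℝ (pointSet P : Set Plane)).extremePoints ℝ
  /-- Every chain is listed from its outermost to its innermost point. -/
  inward : ∀ t i j, i < j → dist (P t j) o < dist (P t i) o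
  /-- The part `A ∪ B` is convex to the right: it turns to the right when traversed inwards. -/
  convex_AB : ∀ t i j l, i < j → j < l → InAB l → IsRight (P t i) (P t j) (P t l)
  /-- The subchain `C` is convex to the left: it turns to the left when traversed inwards. -/
  convex_C : ∀ t i j l, InC i → i < j → j < l → IsLeft (P t i) (P t j) (P t l)
  /-- Lines spanned by two points of `A ∪ B` leave the next chain to the right. -/
  line_AB_next : ∀ t i j l, i < j → InAB j → IsRight (P t i) (P t j) (P (t + 1) l)
  /-- Lines spanned by two points of `A ∪ B` leave the subchain `C` of their chain to the left. -/
  line_AB_C : ∀ t i j l, i < j → InAB j → InC l → IsLeft (P t i) (P t j) (P t l)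
  /-- Lines spanned by two points of `A ∪ B` leave the remaining chain to the left. -/
  line_AB_rest : ∀ t i j l, i < j → InAB j → IsLeft (P t i) (P t j) (P (t + 2) l)
  /-- Lines spanned by two points of `C` separate `A` (on the left) from `B` (on the right). -/
  line_C_separates : ∀ t i j, InC i → i < j →
    (∀ l, InA l → IsLeft (P t i) (P t j) (P t l)) ∧
    (∀ l, InB l → IsRight (P t i) (P t j) (P t l))
  /-- Also the lines spanned by a point of `C` and a point of the subchain `C` of the remaining
  chain separate `A` from `B`. -/
  line_CC_separates : ∀ t i j, InC i → InC j →
    (∀ l, InA l → IsLeft (P t i) (P (t + 2) j) (P t l)) ∧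
    (∀ l, InB l → IsRight (P t i) (P (t + 2) j) (P t l))
  /-- Lines spanned by two points of `C` leave the other two subchains `C` to the right. -/
  line_C_C : ∀ t s i j l, s ≠ t → InC i → i < j → InC l → IsRight (P t i) (P t j) (P s l)
  /-- The (counterclockwise) triangle of the innermost points of the three subchains `B` contains
  all subchains `C` in its interior. -/
  triangle_B : ∀ (t s : Fin 3) (b i : Fin (4 * m)), (b : ℕ) + 1 = 3 * m → InC i →
    IsLeft (P t b) (P (t + 1) b) (P s i)

/-! The number of points to the right of every ordered pair is either computed exactly or shown to
be at least `5 * m`, which exceeds every admissible `k`; the small counts are then summed as lattice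
points.

The hypotheses mostly fix orientations of triples with two points in one chain. Grassmann-Plücker
relations and the triangle of innermost B points extend this to all triples needed: `area2_cross`
(one point per chain), `area2_next`, and `area2_rest_pos` with its exceptions `area2_rest_neg`.

Write D for `(k - 4 * m + 2).choose 2`. A pair from index i to index j of the next chain has i + j
points on its right, apart from pairs irrelevant for `k < 5 * m`. The square of side `4 * m` cuts
two corners off the triangle i + j ≤ k, so these pairs number `(k + 2).choose 2` - 2D. Three further
families each contribute D: from A inwards to B, from C outwards to A, and from B to the C of the
remaining chain. The net total per chain is `(k + 2).choose 2` + D (`numLeEdges_pointSet`).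

For existence, A ∪ B and C are placed on two flat parabolas in the basis 1, exp(2πi/3). Rotation
invariance reduces each condition to a polynomial inequality on a small box of parameters. -/

section Area

variable (p q r s u : Plane)

theorem area2_rotate : area2 p q r = area2 q r p := by unfold area2; ring

theorem area2_swap : area2 p q r = -area2 p r q := by unfold area2; ring

theorem area2_swap_left : area2 p q r = -area2 q p r := by unfold area2; ring

theorem area2_self_left : area2 p p r = 0 := by unfold area2; ring

theorem area2_self_right : area2 p r r = 0 := by unfold area2; ring

theorem area2_self_outer : area2 p r p = 0 := by unfold area2; ring

/-- The four signed areas spanned by four points are linearly dependent. -/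
theorem area2_four : area2 p q r = area2 s q r + area2 p s r - area2 p s q := by
  unfold area2; ring

/-- The Grassmann-Plücker relation of signed areas. -/
theorem area2_pluecker :
    area2 u p q * area2 u r s - area2 u p r * area2 u q s + area2 u p s * area2 u q r = 0 := by
  unfold area2; ring

/-- Barycentric expansion of a signed area with respect to the triangle `r s u`. -/
theorem area2_barycentric (x : Plane) :
    area2 p q x * area2 r s u =
      area2 s u x * area2 p q r + area2 u r x * area2 p q s + area2 r s x * area2 p q u := by
  unfold area2; ring

/-- If `x` lies to the left of `p r` and of `p s`, and the line `u p` has `r` and `x` on its left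
but `s` on its right, then `s` lies to the right of `p r`. -/
theorem area2_neg_of_separated {x : Plane} (h1 : 0 < area2 p r x) (h2 : 0 < area2 p s x)
    (h3 : 0 < area2 u p r) (h4 : 0 < area2 u p x) (h5 : area2 u p s < 0) :
    area2 p r s < 0 := by
  have key : area2 p r x * area2 u p s
      = area2 p s x * area2 u p r + area2 p r s * area2 u p x := by unfold area2; ring
  by_contra! h
  have := mul_pos h2 h3
  have := mul_nonneg h h4.le
  have := mul_neg_of_pos_of_neg h1 h5
  linarith

end Area

theorem Fin.add_one_add_one_three (t : Fin 3) : t + 1 + 1 = t + 2 := by fin_cases t <;> rfl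
theorem Fin.add_one_add_two_three (t : Fin 3) : t + 1 + 2 = t := by fin_cases t <;> rfl
theorem Fin.add_two_add_one_three (t : Fin 3) : t + 2 + 1 = t := by fin_cases t <;> rfl
theorem Fin.add_two_add_two_three (t : Fin 3) : t + 2 + 2 = t + 1 := by fin_cases t <;> rfl

theorem Fin.self_ne_add_one_three (t : Fin 3) : t ≠ t + 1 := by revert t; decide
theorem Fin.add_one_ne_self_three (t : Fin 3) : t + 1 ≠ t := by revert t; decide
theorem Fin.add_two_ne_self_three (t : Fin 3) : t + 2 ≠ t := by revert t; decide
theorem Fin.add_two_ne_add_one_three (t : Fin 3) : t + 2 ≠ t + 1 := by revert t; decide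

theorem Fin.cases_add_three (t s : Fin 3) : s = t ∨ s = t + 1 ∨ s = t + 2 := by
  revert t s; decide

/-! ### Orientations of triples from several chains -/

namespace IsThreeChainConfig

variable {m : ℕ} {o : Plane} {P : Fin 3 → Fin (4 * m) → Plane}

theorem exists_lastB (hm : 0 < m) : ∃ b : Fin (4 * m), (b : ℕ) + 1 = 3 * m :=
  ⟨⟨3 * m - 1, by omega⟩, by simp only; omega⟩

theorem le_area2_lastB {b : Fin (4 * m)} (hb : (b : ℕ) + 1 = 3 * m)
    {X : Plane} {i : Fin (4 * m)} (hi : InAB i) (t : Fin 3)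
    (H : i < b → 0 < area2 (P t i) (P t b) X) : 0 ≤ area2 (P t i) (P t b) X := by
  rcases eq_or_ne i b with rfl | hne
  · rw [area2_self_left]
  · refine (H ?_).le
    unfold InAB at hi
    rw [Fin.lt_def]
    have : (i : ℕ) ≠ b := fun e => hne (Fin.ext e)
    omega

variable (h : IsThreeChainConfig m o P) {b : Fin (4 * m)} (hb : (b : ℕ) + 1 = 3 * m)
include h hb

theorem lastB_rest {i : Fin (4 * m)} (hi : InAB i) (t l) :
    0 ≤ area2 (P t i) (P t b) (P (t + 2) l) :=
  le_area2_lastB hb hi t fun hib => h.line_AB_rest t i b l hib (by unfold InAB; omega)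

theorem lastB_C {i l : Fin (4 * m)} (hi : InAB i) (hl : InC l) (t) :
    0 ≤ area2 (P t i) (P t b) (P t l) :=
  le_area2_lastB hb hi t fun hib => h.line_AB_C t i b l hib (by unfold InAB; omega) hl

theorem lastB_next {i : Fin (4 * m)} (hi : InAB i) (t l) :
    area2 (P t i) (P t b) (P (t + 1) l) ≤ 0 := by
  rcases eq_or_ne i b with rfl | hne
  · rw [area2_self_left]
  · refine (h.line_AB_next t i b l ?_ (by unfold InAB; omega)).le
    unfold InAB at hi
    rw [Fin.lt_def]
    have : (i : ℕ) ≠ b := fun e => hne (Fin.ext e)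
    omega

theorem triangle {c : Fin (4 * m)} (hc : InC c) (t s) :
    0 < area2 (P t b) (P (t + 1) b) (P s c) ∧ 0 < area2 (P (t + 1) b) (P (t + 2) b) (P s c) ∧
      0 < area2 (P (t + 2) b) (P t b) (P s c) := by
  have h0 := h.triangle_B t s b c hb hc
  have h1 := h.triangle_B (t + 1) s b c hb hc
  have h2 := h.triangle_B (t + 2) s b c hb hc
  rw [Fin.add_one_add_one_three] at h1
  rw [Fin.add_two_add_one_three] at h2
  exact ⟨h0, h1, h2⟩

/-- An interior point, here any point of C, cuts the triangle into three positively oriented ones.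
-/
theorem area2_lastB_pos {c : Fin (4 * m)} (hc : InC c) (t) :
    0 < area2 (P t b) (P (t + 1) b) (P (t + 2) b) := by
  obtain ⟨h0, h1, h2⟩ := h.triangle hb hc t t
  have : area2 (P t b) (P (t + 1) b) (P (t + 2) b) = area2 (P t b) (P (t + 1) b) (P t c)
    + area2 (P (t + 1) b) (P (t + 2) b) (P t c) + area2 (P (t + 2) b) (P t b) (P t c) := by
    unfold area2; ring
  linarith

/-- The triangle of innermost B points is deformed one vertex at a time. Sliding a vertex outwards
along A ∪ B adds two signed areas that are nonnegative by `lastB_rest` and `lastB_next`. -/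
theorem cross_AB_AB_AB {c i j l : Fin (4 * m)} (hc : InC c) (hi : InAB i) (hj : InAB j)
    (hl : InAB l) (t) : 0 < area2 (P t i) (P (t + 1) j) (P (t + 2) l) := by
  have move : ∀ (t : Fin 3) {i j l : Fin (4 * m)}, InAB i →
      0 < area2 (P t b) (P (t + 1) j) (P (t + 2) l) →
      0 < area2 (P t i) (P (t + 1) j) (P (t + 2) l) := by
    intro t i j l hi h0
    rw [area2_four _ _ _ (P t b)]
    have := h.lastB_rest hb hi t l
    have := h.lastB_next hb hi t j
    linarith
  have s1 := move t hi (h.area2_lastB_pos hb hc t)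
  have s2 := @move (t + 1) j b i hj (by
    rwa [Fin.add_one_add_one_three, Fin.add_one_add_two_three, ← area2_rotate])
  rw [Fin.add_one_add_one_three, Fin.add_one_add_two_three] at s2
  have s3 := @move (t + 2) l i j hl (by
    rwa [Fin.add_two_add_one_three, Fin.add_two_add_two_three, ← area2_rotate])
  rwa [Fin.add_two_add_one_three, Fin.add_two_add_two_three, area2_rotate] at s3

/-- The signed area is affine in its last point, which is a positive combination of the three
innermost B points; there the values are nonnegative, and positive at the third. -/
theorem cross_AB_AB_C {c i j : Fin (4 * m)} (hi : InAB i) (hj : InAB j) (hc : InC c) (t s) :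
    0 < area2 (P t i) (P (t + 1) j) (P s c) := by
  have hbAB : InAB b := by unfold InAB; omega
  obtain ⟨h0, h1, h2⟩ := h.triangle hb hc t s
  have key := area2_barycentric (P t i) (P (t + 1) j) (P t b) (P (t + 1) b) (P (t + 2) b) (P s c)
  have hB := h.area2_lastB_pos hb hc t
  have a2 := h.cross_AB_AB_AB hb hc hi hj hbAB t
  have a0 : 0 ≤ area2 (P t i) (P (t + 1) j) (P t b) := by
    have := h.lastB_next hb hi t j
    rw [area2_swap]; linarith
  have a1 : 0 ≤ area2 (P t i) (P (t + 1) j) (P (t + 1) b) := by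
    have := h.lastB_rest hb hj (t + 1) i
    rwa [Fin.add_one_add_two_three, area2_rotate, area2_rotate] at this
  have := mul_pos h0 a2
  have := mul_nonneg h1.le a0
  have := mul_nonneg h2.le a1
  exact pos_of_mul_pos_left (by linarith) hB.le

theorem cross_C_AB_C {c q e : Fin (4 * m)} (hc : InC c) (hq : InAB q) (he : InC e) (t) :
    0 < area2 (P t c) (P (t + 1) q) (P (t + 2) e) := by
  have hbAB : InAB b := by unfold InAB; omega
  let a : Fin (4 * m) := ⟨0, by omega⟩
  have hab : a < b := by rw [Fin.lt_def]; simp only [a]; omega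
  -- Seen from the innermost B point of chain `t + 1`, the line through it and `a` separates the two
  -- C points, while the triangle puts the B point of chain `t` to the left of both rays. Afterwards
  -- `b` is moved to `q`.
  have base : area2 (P (t + 1) b) (P t c) (P (t + 2) e) < 0 := by
    apply area2_neg_of_separated (P (t + 1) b) (P t c) (P (t + 2) e) (P (t + 1) a) (x := P t b)
    · rw [area2_rotate, area2_rotate]; exact (h.triangle hb hc t t).1
    · rw [area2_rotate, area2_rotate]; exact (h.triangle hb he t (t + 2)).1
    · simpa [IsLeft, IsRight, Fin.add_one_add_two_three] using h.line_AB_rest (t + 1) a b c hab hbAB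
    · simpa [IsLeft, IsRight, Fin.add_one_add_two_three] using h.line_AB_rest (t + 1) a b b hab hbAB
    · simpa [IsLeft, IsRight, Fin.add_one_add_one_three] using h.line_AB_next (t + 1) a b e hab hbAB
  have h1 := h.lastB_rest hb hq (t + 1) c
  have h2 := h.lastB_next hb hq (t + 1) e
  rw [Fin.add_one_add_two_three] at h1
  rw [Fin.add_one_add_one_three] at h2
  rw [area2_swap_left, area2_four _ _ _ (P (t + 1) b)]
  linarith

theorem cross_AB_C {p d x : Fin (4 * m)} (hp : InAB p) (hd : InC d) (hx : InC x) {t s}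
    (hs : s ≠ t + 1) : 0 < area2 (P t p) (P (t + 1) d) (P s x) := by
  have hbAB : InAB b := by unfold InAB; omega
  let a : Fin (4 * m) := ⟨0, by omega⟩
  have hab : a < b := by rw [Fin.lt_def]; simp only [a]; omega
  have hxs : 0 < area2 (P t a) (P t b) (P s x) ∧ 0 ≤ area2 (P t p) (P t b) (P s x) := by
    rcases Fin.cases_add_three t s with rfl | rfl | rfl
    · exact ⟨h.line_AB_C _ a b x hab hbAB hx, h.lastB_C hb hp hx _⟩
    · exact absurd rfl hs
    · exact ⟨h.line_AB_rest _ a b x hab hbAB, h.lastB_rest hb hp _ _⟩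
  have base : area2 (P t b) (P s x) (P (t + 1) d) < 0 := by
    apply area2_neg_of_separated (P t b) (P s x) (P (t + 1) d) (P t a) (x := P (t + 2) b)
    · rw [area2_rotate, area2_rotate]; exact (h.triangle hb hx t s).2.2
    · rw [area2_rotate, area2_rotate]; exact (h.triangle hb hd t (t + 1)).2.2
    · exact hxs.1
    · exact h.line_AB_rest t a b b hab hbAB
    · exact h.line_AB_next t a b d hab hbAB
  have h1 := h.lastB_next hb hp t d
  rw [area2_four _ _ _ (P t b)]
  rw [area2_swap] at base
  linarith [hxs.2]

/-- In the Plücker relation centred at the point `e`, with the B points of chains `t` and `t + 1` as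
auxiliary points, every other sign is known; `line_CC_separates` supplies one of them. -/
theorem cross_C_C_C {c d e : Fin (4 * m)} (hc : InC c) (hd : InC d) (he : InC e) (t) :
    0 < area2 (P t c) (P (t + 1) d) (P (t + 2) e) := by
  have hbAB : InAB b := by unfold InAB; omega
  have hbB : InB b := by unfold InB; omega
  have key : area2 (P (t + 2) e) (P t b) (P (t + 1) b) *
      area2 (P t c) (P (t + 1) d) (P (t + 2) e) =
      area2 (P t c) (P (t + 2) e) (P (t + 1) b) * area2 (P (t + 2) e) (P (t + 1) d) (P t b) -
      area2 (P t c) (P (t + 2) e) (P t b) * area2 (P (t + 2) e) (P (t + 1) d) (P (t + 1) b) := by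
    unfold area2; ring
  have f0 : area2 (P t c) (P (t + 2) e) (P t b) < 0 := (h.line_CC_separates t c e hc he).2 b hbB
  have f1 := h.cross_C_AB_C hb hc hbAB he t
  have g0 := h.cross_AB_C hb (s := t + 2) hbAB hd he (t := t) (Fin.add_two_ne_add_one_three t)
  have g1 := h.cross_AB_C hb (s := t + 1) hbAB he hd (t := t + 1) (Fin.self_ne_add_one_three _)
  have h0 := (h.triangle hb he t (t + 2)).1
  rw [Fin.add_one_add_one_three, area2_rotate] at g1
  rw [area2_swap] at f1
  rw [area2_rotate, area2_rotate, area2_swap] at g0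
  rw [area2_rotate, area2_rotate] at h0
  refine pos_of_mul_pos_right ?_ h0.le
  rw [key]
  nlinarith [mul_pos_of_neg_of_neg f0 (neg_pos.1 g0), mul_pos (neg_pos.2 f0) g1,
    mul_pos f1 g0]

theorem line_C_AB_rest {i j l : Fin (4 * m)} (hi : InC i) (hij : i < j) (hl : InAB l) (t) :
    0 < area2 (P t i) (P t j) (P (t + 2) l) := by
  have hbAB : InAB b := by unfold InAB; omega
  have hbB : InB b := by unfold InB; omega
  -- Centred at `P t i`. Any C point of the remaining chain would do as auxiliary point; the one
  -- with index `i` is at hand.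
  have key := area2_pluecker (P (t + 2) i) (P t j) (P (t + 2) l) (P t b) (P t i)
  have e1 : area2 (P t i) (P t j) (P (t + 2) i) < 0 :=
    h.line_C_C t (t + 2) i j i (Fin.add_two_ne_self_three t) hi hij hi
  have e2 : 0 < area2 (P t i) (P (t + 2) i) (P (t + 2) l) := by
    have := h.cross_AB_C hb (s := t + 2) hl hi hi (t := t + 2) (Fin.self_ne_add_one_three _)
    rwa [Fin.add_two_add_one_three, area2_rotate] at this
  have e3 : 0 < area2 (P t i) (P (t + 2) l) (P t b) := by
    have := h.cross_AB_AB_C hb hl hbAB hi (t + 2) t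
    rwa [Fin.add_two_add_one_three, area2_rotate, area2_rotate] at this
  have e4 : area2 (P t i) (P (t + 2) i) (P t b) < 0 := (h.line_CC_separates t i i hi hi).2 b hbB
  have e5 : area2 (P t i) (P t j) (P t b) < 0 := (h.line_C_separates t i j hi hij).2 b hbB
  rw [area2_swap] at e1
  by_contra! hc
  have := mul_pos (neg_lt_zero.1 e1) e3
  have := mul_neg_of_pos_of_neg e2 e5
  have := mul_nonneg_of_nonpos_of_nonpos e4.le hc
  linarith

theorem line_C_AB_next {i j l : Fin (4 * m)} (hi : InC i) (hij : i < j) (hl : InAB l) (t) :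
    area2 (P t i) (P t j) (P (t + 1) l) < 0 := by
  have hbAB : InAB b := by unfold InAB; omega
  have hbB : InB b := by unfold InB; omega
  have key := area2_pluecker (P (t + 2) i) (P t j) (P (t + 1) l) (P t b) (P t i)
  have e1 : area2 (P t i) (P t j) (P (t + 2) i) < 0 :=
    h.line_C_C t (t + 2) i j i (Fin.add_two_ne_self_three t) hi hij hi
  have e2 := h.cross_C_AB_C hb hi hl hi t
  have e3 := h.cross_AB_AB_C hb hbAB hl hi t t
  have e4 : area2 (P t i) (P (t + 2) i) (P t b) < 0 := (h.line_CC_separates t i i hi hi).2 b hbB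
  have e5 : area2 (P t i) (P t j) (P t b) < 0 := (h.line_C_separates t i j hi hij).2 b hbB
  rw [area2_swap] at e1 e2
  rw [area2_rotate, area2_rotate, area2_swap] at e3
  by_contra! hc
  have := mul_pos (neg_lt_zero.1 e1) e3
  have := mul_pos e2 (neg_pos.2 e5)
  have := mul_nonneg (neg_nonneg.2 e4.le) hc
  linarith

end IsThreeChainConfig

/-! ### Uniform orientation rules for whole chains -/

namespace IsThreeChainConfig

variable {m : ℕ} {o : Plane} {P : Fin 3 → Fin (4 * m) → Plane} (h : IsThreeChainConfig m o P)
include h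

/-- Every line spanned by a chain, directed inwards, leaves the next chain to the right. -/
theorem area2_next {l i : Fin (4 * m)} (hli : l < i) (t j) :
    area2 (P t l) (P t i) (P (t + 1) j) < 0 := by
  have hm : 0 < m := by have := l.2; omega
  obtain ⟨b, hb⟩ := exists_lastB hm
  rcases lt_or_ge (i : ℕ) (3 * m) with hi | hi
  · exact h.line_AB_next t l i j hli hi
  rcases lt_or_ge (l : ℕ) (3 * m) with hl | hl
  · rw [area2_swap, neg_lt_zero]
    rcases lt_or_ge (j : ℕ) (3 * m) with hj | hj
    · exact h.cross_AB_AB_C hb hl hj hi t t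
    · exact h.cross_AB_C hb hl hj hi (Fin.self_ne_add_one_three t)
  · rcases lt_or_ge (j : ℕ) (3 * m) with hj | hj
    · exact h.line_C_AB_next hb hl hli hj t
    · exact h.line_C_C t (t + 1) l i j (Fin.add_one_ne_self_three t) hl hli hj

/-- The lines spanned by a chain, directed inwards, leave the remaining chain to the left, up to
the exceptions in `area2_rest_neg`. -/
theorem area2_rest_pos {l i j : Fin (4 * m)} (hli : l < i)
    (hex : (l : ℕ) < 2 * m ∨ (i : ℕ) < 3 * m ∨ (j : ℕ) < 3 * m) (t) :
    0 < area2 (P t l) (P t i) (P (t + 2) j) := by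
  have hm : 0 < m := by have := l.2; omega
  obtain ⟨b, hb⟩ := exists_lastB hm
  rcases lt_or_ge (i : ℕ) (3 * m) with hi | hi
  · exact h.line_AB_rest t l i j hli hi
  rcases lt_or_ge (j : ℕ) (3 * m) with hj | hj
  · rcases lt_or_ge (l : ℕ) (3 * m) with hl | hl
    · have := h.cross_AB_AB_C hb hj hl hi (t + 2) t
      rwa [Fin.add_two_add_one_three, area2_rotate] at this
    · exact h.line_C_AB_rest hb hl hli hj t
  · rw [area2_rotate]
    exact (h.line_CC_separates t i j hi hj).1 l (by unfold InA; omega)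

theorem area2_rest_neg {l i j : Fin (4 * m)} (hli : l < i) (hl : 2 * m ≤ (l : ℕ))
    (hi : 3 * m ≤ (i : ℕ)) (hj : 3 * m ≤ (j : ℕ)) (t) :
    area2 (P t l) (P t i) (P (t + 2) j) < 0 := by
  rcases lt_or_ge (l : ℕ) (3 * m) with hl3 | hl3
  · rw [area2_rotate]
    exact (h.line_CC_separates t i j hi hj).2 l ⟨hl, hl3⟩
  · exact h.line_C_C t (t + 2) l i j (Fin.add_two_ne_self_three t) hl3 hli hj

/-- Points of the three chains in cyclic order form a counterclockwise triangle. -/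
theorem area2_cross (t) (i j l) : 0 < area2 (P t i) (P (t + 1) j) (P (t + 2) l) := by
  have hm : 0 < m := by have := l.2; omega
  obtain ⟨b, hb⟩ := exists_lastB hm
  -- Eight cases, by which vertices lie in C; cyclic relabelling reduces them to the five `cross`
  -- lemmas.
  rcases lt_or_ge (i : ℕ) (3 * m) with hi | hi <;> rcases lt_or_ge (j : ℕ) (3 * m) with hj | hj <;>
    rcases lt_or_ge (l : ℕ) (3 * m) with hl | hl
  · exact h.cross_AB_AB_AB hb (c := ⟨3 * m, by omega⟩) le_rfl hi hj hl t
  · exact h.cross_AB_AB_C hb hi hj hl t _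
  · have := h.cross_AB_AB_C hb hl hi hj (t + 2) (t + 1)
    rwa [Fin.add_two_add_one_three, area2_rotate] at this
  · exact h.cross_AB_C hb hi hj hl (Fin.add_two_ne_add_one_three t)
  · have := h.cross_AB_AB_C hb hj hl hi (t + 1) t
    rwa [Fin.add_one_add_one_three, ← area2_rotate] at this
  · exact h.cross_C_AB_C hb hi hj hl t
  · have := h.cross_AB_C hb (s := t + 1) hl hi hj (t := t + 2) (by
      rw [Fin.add_two_add_one_three]; exact Fin.add_one_ne_self_three t)
    rwa [Fin.add_two_add_one_three, area2_rotate] at this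
  · exact h.cross_C_C_C hb hi hj hl t

end IsThreeChainConfig

/-! ### Counting the points of one chain to the right of a line -/

section Count

variable {m : ℕ} {P : Fin 3 → Fin (4 * m) → Plane}

open Classical in
/-- The number of points of chain `u` to the right of the line `p q`. -/
noncomputable def chainRight (P : Fin 3 → Fin (4 * m) → Plane) (p q : Plane) (u : Fin 3) : ℕ :=
  (Finset.univ.filter fun l => IsRight p q (P u l)).card

theorem le_chainRight {p q : Plane} {u : Fin 3} (a b : ℕ) (hb : b ≤ 4 * m)
    (h : ∀ l : Fin (4 * m), a ≤ l → (l : ℕ) < b → IsRight p q (P u l)) :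
    b - a ≤ chainRight P p q u := by
  classical
  unfold chainRight
  have : (Finset.univ.filter fun l : Fin (4 * m) => a ≤ (l : ℕ) ∧ (l : ℕ) < b).card = b - a := by
    rw [← Nat.card_Ico a b]
    refine Finset.card_bij (fun l _ => (l : ℕ)) ?_ ?_ ?_
    · intro l hl; simpa using hl
    · intro l _ l' _ e; exact Fin.ext e
    · intro x hx
      rw [Finset.mem_Ico] at hx
      exact ⟨⟨x, by omega⟩, by simpa using hx, rfl⟩
  rw [← this]
  refine Finset.card_le_card fun l hl => ?_
  simp only [Finset.mem_filter, Finset.mem_univ, true_and] at hl ⊢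
  exact h l hl.1 hl.2

theorem chainRight_eq {p q : Plane} {u : Fin 3} (a b c : ℕ) (hab : a ≤ b) (hbc : b ≤ c)
    (hc : c ≤ 4 * m)
    (h1 : ∀ l : Fin (4 * m), (l : ℕ) < a ∨ b ≤ (l : ℕ) ∧ (l : ℕ) < c → area2 p q (P u l) < 0)
    (h2 : ∀ l : Fin (4 * m), a ≤ (l : ℕ) → (l : ℕ) < b ∨ c ≤ (l : ℕ) → 0 ≤ area2 p q (P u l)) :
    chainRight P p q u = a + (c - b) := by
  classical
  unfold chainRight
  have : (Finset.univ.filter fun l => IsRight p q (P u l)).map Fin.valEmbedding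
      = Finset.range a ∪ Finset.Ico b c := by
    ext x
    simp only [Finset.mem_map, Finset.mem_filter, Finset.mem_univ, true_and, Finset.mem_union,
      Finset.mem_range, Finset.mem_Ico, Fin.valEmbedding_apply]
    constructor
    · rintro ⟨l, hl, rfl⟩
      by_contra hx
      exact absurd hl (not_lt.2 (h2 l (by omega) (by omega)))
    · intro hx
      exact ⟨⟨x, by omega⟩, h1 ⟨x, by omega⟩ hx, rfl⟩
  rw [← Finset.card_map Fin.valEmbedding, this, Finset.card_union_of_disjoint, Finset.card_range,
    Nat.card_Ico]
  rw [Finset.disjoint_left]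
  intro x
  simp only [Finset.mem_range, Finset.mem_Ico]
  omega

theorem chainRight_eq_zero {p q : Plane} {u : Fin 3} (h : ∀ l, 0 ≤ area2 p q (P u l)) :
    chainRight P p q u = 0 := by
  simpa using chainRight_eq (P := P) (u := u) 0 0 0 le_rfl le_rfl (Nat.zero_le _)
    (fun l hl => by omega) (fun l _ _ => h l)

theorem chainRight_eq_all {p q : Plane} {u : Fin 3} (h : ∀ l, area2 p q (P u l) < 0) :
    chainRight P p q u = 4 * m := by
  simpa using chainRight_eq (P := P) (u := u) 0 0 (4 * m) le_rfl (Nat.zero_le _) le_rfl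
    (fun l _ => h l) (fun l _ hl => by have := l.2; omega)

theorem chainRight_eq_prefix {p q : Plane} {u : Fin 3} (a : Fin (4 * m))
    (h1 : ∀ l, l < a → area2 p q (P u l) < 0) (h2 : ∀ l, a < l → 0 ≤ area2 p q (P u l))
    (h3 : area2 p q (P u a) = 0) : chainRight P p q u = a := by
  have := chainRight_eq (P := P) (p := p) (q := q) (u := u) a (4 * m) (4 * m) a.2.le le_rfl le_rfl
    (fun l hl => h1 l (by rw [Fin.lt_def]; omega)) (fun l hl _ => by
      rcases hl.eq_or_lt with e | e
      · rw [← Fin.ext e, h3]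
      · exact h2 l e)
  simpa using this

end Count

/-! ### Signs for lines to the next chain, and distinctness of the points -/

namespace IsThreeChainConfig

variable {m : ℕ} {o : Plane} {P : Fin 3 → Fin (4 * m) → Plane} (h : IsThreeChainConfig m o P)
include h

section Signs

variable {i j l : Fin (4 * m)} (t : Fin 3)

theorem next_own_neg (hl : l < i) : area2 (P t i) (P (t + 1) j) (P t l) < 0 := by
  rw [area2_rotate, area2_rotate]; exact h.area2_next hl t j

theorem next_own_pos (hl : i < l) : 0 < area2 (P t i) (P (t + 1) j) (P t l) := by
  rw [area2_swap, neg_pos]; exact h.area2_next hl t j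

theorem next_next_neg (hl : l < j)
    (hex : (l : ℕ) < 2 * m ∨ (j : ℕ) < 3 * m ∨ (i : ℕ) < 3 * m) :
    area2 (P t i) (P (t + 1) j) (P (t + 1) l) < 0 := by
  have := h.area2_rest_pos hl hex (t + 1)
  rw [Fin.add_one_add_two_three] at this
  rw [area2_rotate, area2_swap_left]; linarith

theorem next_next_pos (hl : j < l)
    (hex : (j : ℕ) < 2 * m ∨ (l : ℕ) < 3 * m ∨ (i : ℕ) < 3 * m) :
    0 < area2 (P t i) (P (t + 1) j) (P (t + 1) l) := by
  have := h.area2_rest_pos hl hex (t + 1)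
  rw [Fin.add_one_add_two_three] at this
  rwa [area2_rotate]

theorem next_next_pos_of_lt (hl : l < j) (hl2 : 2 * m ≤ (l : ℕ)) (hj : 3 * m ≤ (j : ℕ))
    (hi : 3 * m ≤ (i : ℕ)) : 0 < area2 (P t i) (P (t + 1) j) (P (t + 1) l) := by
  have := h.area2_rest_neg hl hl2 hj hi (t + 1)
  rw [Fin.add_one_add_two_three] at this
  rw [area2_rotate, area2_swap_left]; linarith

theorem next_next_neg_of_lt (hl : j < l) (hj : 2 * m ≤ (j : ℕ)) (hl3 : 3 * m ≤ (l : ℕ))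
    (hi : 3 * m ≤ (i : ℕ)) : area2 (P t i) (P (t + 1) j) (P (t + 1) l) < 0 := by
  have := h.area2_rest_neg hl hj hl3 hi (t + 1)
  rw [Fin.add_one_add_two_three] at this
  rwa [area2_rotate]

end Signs

/-- Two coinciding points would span a triangle of area zero with a third point, against the strict
signs. -/
theorem injective : Function.Injective fun x : Fin 3 × Fin (4 * m) => P x.1 x.2 := by
  have cross : ∀ t i j, P t i ≠ P (t + 1) j := by
    intro t i j e
    have := h.area2_cross t i j j
    rw [e, area2_self_left] at this
    exact this.false
  have own : ∀ t i j, i < j → P t i ≠ P t j := by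
    intro t i j hij e
    have := h.area2_next hij t j
    rw [e, area2_self_left] at this
    exact this.false
  rintro ⟨t, i⟩ ⟨s, j⟩ e
  simp only at e
  rcases Fin.cases_add_three t s with rfl | rfl | rfl
  · rcases lt_trichotomy i j with hij | rfl | hij
    · exact absurd e (own _ _ _ hij)
    · rfl
    · exact absurd e.symm (own _ _ _ hij)
  · exact absurd e (cross _ _ _)
  · refine absurd e.symm ?_
    have := cross (t + 2) j i
    rwa [Fin.add_two_add_one_three] at this

theorem card_pointSet : (pointSet P).card = 12 * m := by
  classical
  have : (pointSet P).card = (Finset.univ : Finset (Fin 3 × Fin (4 * m))).card := by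
    unfold pointSet
    convert Finset.card_image_of_injective _ h.injective
  rw [this, Finset.card_univ, Fintype.card_prod, Fintype.card_fin, Fintype.card_fin]
  ring

end IsThreeChainConfig

open Classical in
/-- The number of points of `S` to the right of the line `p q`. -/
noncomputable def rightCount (S : Finset Plane) (p q : Plane) : ℕ :=
  (S.filter fun r => IsRight p q r).card

theorem numLeEdges_eq (S : Finset Plane) (k : ℕ) :
    numLeEdges S k = ∑ p ∈ S, ∑ q ∈ S, if p ≠ q ∧ rightCount S p q ≤ k then 1 else 0 := by
  classical
  rw [← Finset.sum_product' S S (fun p q => if p ≠ q ∧ rightCount S p q ≤ k then 1 else 0),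
    ← Finset.card_filter]
  unfold numLeEdges
  rw [Finset.card_eq_sum_card_fiberwise (f := fun e => rightCount S e.1 e.2)
    (t := Finset.range (k + 1))]
  · refine Finset.sum_congr rfl fun j hj => ?_
    rw [Finset.mem_range] at hj
    unfold edgesOf
    rw [Finset.filter_filter]
    congr 1
    ext e
    simp only [Finset.mem_filter]
    unfold rightCount
    constructor
    · rintro ⟨h1, h2, h3⟩; exact ⟨h1, ⟨h2, by omega⟩, h3⟩
    · rintro ⟨h1, ⟨h2, -⟩, h3⟩; exact ⟨h1, h2, h3⟩
  · intro e he
    simp only [Finset.coe_filter, Set.mem_ofPred_eq] at he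
    simp only [Finset.coe_range, Set.mem_Iio]
    omega

theorem Fin.sum_three_shift {M : Type*} [AddCommMonoid M] (f : Fin 3 → M) (t : Fin 3) :
    ∑ u, f u = f t + f (t + 1) + f (t + 2) := by
  rw [← Equiv.sum_comp (Equiv.addLeft t) f, Fin.sum_univ_three]
  simp

/-! ### Right counts of all ordered pairs -/

namespace IsThreeChainConfig

variable {m : ℕ} {o : Plane} {P : Fin 3 → Fin (4 * m) → Plane} (h : IsThreeChainConfig m o P)
include h

theorem sum_pointSet {M : Type*} [AddCommMonoid M] (f : Plane → M) :
    ∑ p ∈ pointSet P, f p = ∑ t, ∑ i, f (P t i) := by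
  classical
  rw [← Fintype.sum_prod_type' (fun t i => f (P t i))]
  have : pointSet P = Finset.univ.image fun x : Fin 3 × Fin (4 * m) => P x.1 x.2 := by
    unfold pointSet; congr
  rw [this, Finset.sum_image fun x _ y _ e => h.injective e]

theorem rightCount_eq (p q : Plane) (t : Fin 3) : rightCount (pointSet P) p q =
    chainRight P p q t + chainRight P p q (t + 1) + chainRight P p q (t + 2) := by
  classical
  rw [← Fin.sum_three_shift (chainRight P p q), rightCount, Finset.card_filter, h.sum_pointSet]
  refine Finset.sum_congr rfl fun u _ => ?_
  rw [chainRight, Finset.card_filter]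

variable {i j : Fin (4 * m)} (t : Fin 3)

/-- On the right lie exactly the points farther out than the endpoint on each of the two chains. -/
theorem rightCount_next (hij : (i : ℕ) < 3 * m ∨ (j : ℕ) < 2 * m) :
    rightCount (pointSet P) (P t i) (P (t + 1) j) = i + j := by
  rw [h.rightCount_eq _ _ t,
    chainRight_eq_prefix i (fun l hl => h.next_own_neg t hl) (fun l hl => (h.next_own_pos t hl).le)
      (area2_self_outer _ _),
    chainRight_eq_prefix j
      (fun l hl => h.next_next_neg t hl (by rw [Fin.lt_def] at hl; omega))
      (fun l hl => (h.next_next_pos t hl (by omega)).le)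
      (area2_self_right _ _),
    chainRight_eq_zero fun l => (h.area2_cross t i j l).le]
  rfl

theorem le_rightCount_next (hi : 3 * m ≤ (i : ℕ)) (hj : 2 * m ≤ (j : ℕ)) :
    5 * m ≤ rightCount (pointSet P) (P t i) (P (t + 1) j) := by
  rw [h.rightCount_eq _ _ t]
  have h1 : 3 * m - 0 ≤ chainRight P (P t i) (P (t + 1) j) t :=
    le_chainRight _ _ (by omega) fun l _ hl => h.next_own_neg t (by rw [Fin.lt_def]; omega)
  have h2 : 2 * m - 0 ≤ chainRight P (P t i) (P (t + 1) j) (t + 1) :=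
    le_chainRight _ _ (by omega) fun l _ hl =>
      h.next_next_neg t (by rw [Fin.lt_def]; omega) (by omega)
  omega

/-- The reversed signs of `area2_rest_neg` put the C of chain `t + 1` on the left. Losing these `m`
points is what lets the count fall below `5 * m`. -/
theorem rightCount_prev (hi : 3 * m ≤ (i : ℕ)) (hj2 : 2 * m ≤ (j : ℕ)) (hj3 : (j : ℕ) < 3 * m) :
    rightCount (pointSet P) (P (t + 1) j) (P t i) = (4 * m - 1 - i) + (3 * m - 1 - j) + 4 * m := by
  rw [h.rightCount_eq _ _ t,
    chainRight_eq (P := P) (u := t) 0 (i + 1) (4 * m) (by omega) (by omega) le_rfl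
      (fun l hl => by
        rw [area2_swap_left, neg_lt_zero]
        exact h.next_own_pos t (by rw [Fin.lt_def]; omega))
      (fun l _ hl => by
        rw [area2_swap_left, neg_nonneg]
        rcases lt_or_ge l i with hli | hli
        · exact (h.next_own_neg t hli).le
        · obtain rfl : l = i := Fin.ext (by rw [Fin.le_def] at hli; omega)
          rw [area2_self_outer]),
    chainRight_eq (P := P) (u := t + 1) 0 (j + 1) (3 * m) (by omega) (by omega) (by omega)
      (fun l hl => by
        rw [area2_swap_left, neg_lt_zero]
        exact h.next_next_pos t (by rw [Fin.lt_def]; omega) (by omega))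
      (fun l _ hl => by
        rw [area2_swap_left, neg_nonneg]
        rcases lt_trichotomy l j with hlj | rfl | hlj
        · exact (h.next_next_neg t hlj (by omega)).le
        · rw [area2_self_right]
        · refine (h.next_next_neg_of_lt t hlj hj2 ?_ hi).le
          rw [Fin.lt_def] at hlj
          omega),
    chainRight_eq_all fun l => by
      rw [area2_swap_left, neg_lt_zero]; exact h.area2_cross t i j l]
  omega

theorem le_rightCount_prev (hij : (i : ℕ) < 3 * m ∨ (j : ℕ) < 2 * m ∨ 3 * m ≤ (j : ℕ)) :
    5 * m ≤ rightCount (pointSet P) (P (t + 1) j) (P t i) := by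
  rw [h.rightCount_eq _ _ t]
  have h3 : chainRight P (P (t + 1) j) (P t i) (t + 2) = 4 * m :=
    chainRight_eq_all fun l => by
      rw [area2_swap_left, neg_lt_zero]; exact h.area2_cross t i j l
  rcases lt_or_ge (i : ℕ) (3 * m) with hi | hi
  · have h1 : 4 * m - 3 * m ≤ chainRight P (P (t + 1) j) (P t i) t :=
      le_chainRight _ _ le_rfl fun l hl _ => by
        rw [IsRight, area2_swap_left, neg_lt_zero]
        exact h.next_own_pos t (by rw [Fin.lt_def]; omega)
    omega
  · rcases lt_or_ge (j : ℕ) (2 * m) with hj | hj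
    · have h2 : 4 * m - 3 * m ≤ chainRight P (P (t + 1) j) (P t i) (t + 1) :=
        le_chainRight _ _ le_rfl fun l hl _ => by
          rw [IsRight, area2_swap_left, neg_lt_zero]
          exact h.next_next_pos t (by rw [Fin.lt_def]; omega) (by omega)
      omega
    · have h2 : 3 * m - 2 * m ≤ chainRight P (P (t + 1) j) (P t i) (t + 1) :=
        le_chainRight _ _ (by omega) fun l hl hl' => by
          rw [IsRight, area2_swap_left, neg_lt_zero]
          exact h.next_next_pos_of_lt t (by rw [Fin.lt_def]; omega) hl (by omega) hi
      omega

theorem rightCount_inward_AB (hij : i < j) (hj : (j : ℕ) < 3 * m) :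
    rightCount (pointSet P) (P t i) (P t j) = i + (3 * m - 1 - j) + 4 * m := by
  have hij' := Fin.lt_def.1 hij
  rw [h.rightCount_eq _ _ t,
    chainRight_eq (P := P) (u := t) i (j + 1) (3 * m) (by omega) (by omega) (by omega)
      (fun l hl => by
        rcases hl with hl | ⟨hl, hl'⟩
        · rw [area2_rotate, area2_rotate]
          exact h.convex_AB t l i j hl hij hj
        · exact h.convex_AB t i j l hij hl hl')
      (fun l hl hl' => by
        rcases hl.eq_or_lt with e | e
        · rw [← Fin.ext e, area2_self_outer]
        rcases hl' with hl' | hl'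
        · rcases (Nat.lt_succ_iff.1 hl').eq_or_lt with e' | e'
          · rw [Fin.ext e', area2_self_right]
          · rw [area2_swap, neg_nonneg]
            exact (h.convex_AB t i l j e e' hj).le
        · exact (h.line_AB_C t i j l hij hj hl').le),
    chainRight_eq_all fun l => h.area2_next hij t l,
    chainRight_eq_zero fun l => (h.area2_rest_pos hij (by omega) t).le]
  omega

/-- Besides the whole next chain, the right side contains B of the own chain if `i` is in A, and C
of the remaining chain otherwise. -/
theorem le_rightCount_inward (hij : i < j) (hj : 3 * m ≤ (j : ℕ)) :
    5 * m ≤ rightCount (pointSet P) (P t i) (P t j) := by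
  rw [h.rightCount_eq _ _ t]
  have h1 : chainRight P (P t i) (P t j) (t + 1) = 4 * m :=
    chainRight_eq_all fun l => h.area2_next hij t l
  rcases lt_or_ge (i : ℕ) (2 * m) with hi | hi
  · have h2 : 3 * m - 2 * m ≤ chainRight P (P t i) (P t j) t :=
      le_chainRight _ _ (by omega) fun l hl hl' => by
        rw [IsRight, area2_swap, neg_lt_zero]
        exact h.line_AB_C t i l j (by rw [Fin.lt_def]; omega) hl' hj
    omega
  · have h2 : 4 * m - 3 * m ≤ chainRight P (P t i) (P t j) (t + 2) :=
      le_chainRight _ _ le_rfl fun l hl _ => h.area2_rest_neg hij hi hj hl t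
    omega

theorem rightCount_outward_C_A (hi : (i : ℕ) < 2 * m) (hj : 3 * m ≤ (j : ℕ)) :
    rightCount (pointSet P) (P t j) (P t i) = i + (4 * m - 1 - j) + 4 * m := by
  have hij : i < j := by rw [Fin.lt_def]; omega
  rw [h.rightCount_eq _ _ t,
    chainRight_eq (P := P) (u := t) i (j + 1) (4 * m) (by omega) (by omega) (by omega)
      (fun l hl => by
        rw [area2_swap_left, neg_lt_zero]
        rcases hl with hl | ⟨hl, hl'⟩
        · rw [area2_rotate, area2_rotate]
          exact h.line_AB_C t l i j hl (by unfold InAB; omega) hj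
        · rw [area2_rotate]
          exact (h.line_C_separates t j l hj hl).1 i hi)
      (fun l hl hl' => by
        rcases hl.eq_or_lt with e | e
        · rw [← Fin.ext e, area2_self_right]
        rcases (show (l : ℕ) ≤ j by have := l.2; omega).eq_or_lt with e' | e'
        · rw [Fin.ext e', area2_self_outer]
        rw [area2_rotate]
        rcases lt_or_ge (l : ℕ) (3 * m) with hl3 | hl3
        · exact (h.line_AB_C t i l j e hl3 hj).le
        · rw [area2_rotate]
          exact ((h.line_C_separates t l j hl3 e').1 i hi).le),
    chainRight_eq_zero fun l => by
      rw [area2_swap_left, neg_nonneg]; exact (h.area2_next hij t l).le,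
    chainRight_eq_all fun l => by
      rw [area2_swap_left, neg_lt_zero]; exact h.area2_rest_pos hij (by omega) t]
  omega

theorem le_rightCount_outward (hij : i < j) (hex : 2 * m ≤ (i : ℕ) ∨ (j : ℕ) < 3 * m) :
    5 * m ≤ rightCount (pointSet P) (P t j) (P t i) := by
  have hij' := Fin.lt_def.1 hij
  rw [h.rightCount_eq _ _ t]
  rcases lt_or_ge (j : ℕ) (3 * m) with hj | hj
  · have h1 : 4 * m - 3 * m ≤ chainRight P (P t j) (P t i) t :=
      le_chainRight _ _ le_rfl fun l hl _ => by
        rw [IsRight, area2_swap_left, neg_lt_zero]; exact h.line_AB_C t i j l hij hj hl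
    have h2 : chainRight P (P t j) (P t i) (t + 2) = 4 * m :=
      chainRight_eq_all fun l => by
        rw [area2_swap_left, neg_lt_zero]; exact h.line_AB_rest t i j l hij hj
    omega
  · have hi : 2 * m ≤ (i : ℕ) := by omega
    have h1 : 2 * m - 0 ≤ chainRight P (P t j) (P t i) t :=
      le_chainRight _ _ (by omega) fun l _ hl => by
        rw [IsRight, area2_swap_left, neg_lt_zero]
        rcases lt_or_ge (i : ℕ) (3 * m) with hi3 | hi3
        · rw [area2_rotate, area2_rotate]
          exact h.line_AB_C t l i j (by rw [Fin.lt_def]; omega) hi3 hj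
        · exact (h.line_C_separates t i j hi3 hij).1 l hl
    have h2 : 3 * m - 0 ≤ chainRight P (P t j) (P t i) (t + 2) :=
      le_chainRight _ _ (by omega) fun l _ hl => by
        rw [IsRight, area2_swap_left, neg_lt_zero]
        exact h.area2_rest_pos hij (by omega) t
    omega

end IsThreeChainConfig

/-! ### Lattice point counts -/

/-- The pairs of natural numbers with sum at most `x`. -/
def pairsLe (x : ℕ) : Finset (ℕ × ℕ) :=
  (Finset.range (x + 1) ×ˢ Finset.range (x + 1)).filter fun y => y.1 + y.2 ≤ x

theorem mem_pairsLe {x : ℕ} {y : ℕ × ℕ} : y ∈ pairsLe x ↔ y.1 + y.2 ≤ x := by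
  simp only [pairsLe, Finset.mem_filter, Finset.mem_product, Finset.mem_range]
  omega

theorem card_pairsLe (x : ℕ) : (pairsLe x).card = (x + 2).choose 2 := by
  induction x with
  | zero => rfl
  | succ x ih =>
    have : pairsLe (x + 1) = pairsLe x ∪ Finset.HasAntidiagonal.antidiagonal (x + 1) := by
      ext y
      rw [Finset.mem_union, mem_pairsLe, mem_pairsLe, Finset.HasAntidiagonal.mem_antidiagonal]
      omega
    rw [this, Finset.card_union_of_disjoint, ih, Finset.Nat.card_antidiagonal,
      Nat.choose_succ_succ' (x + 2) 1, Nat.choose_one_right]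
    · ring
    · rw [Finset.disjoint_left]
      intro y
      rw [mem_pairsLe, Finset.HasAntidiagonal.mem_antidiagonal]
      omega

/-- The square cuts off the two corners with a coordinate at least `N`. They are disjoint as `k < 2
* N`, and a shift by `N` makes each a triangle of size `k - N`. -/
theorem card_filter_add_le {N k : ℕ} (hk : N ≤ k) (hk2 : k < 2 * N) :
    (Finset.univ.filter fun x : Fin N × Fin N => (x.1 : ℕ) + x.2 ≤ k).card
      + 2 * (k - N + 2).choose 2 = (k + 2).choose 2 := by
  have e0 : (Finset.univ.filter fun x : Fin N × Fin N => (x.1 : ℕ) + x.2 ≤ k).card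
      = ((pairsLe k).filter fun y => y.1 < N ∧ y.2 < N).card := by
    refine Finset.card_bij (fun x _ => ((x.1 : ℕ), (x.2 : ℕ))) ?_ ?_ ?_
    · intro x hx
      simp only [Finset.mem_filter, mem_pairsLe, Finset.mem_univ, true_and] at hx ⊢
      exact ⟨hx, x.1.2, x.2.2⟩
    · intro x _ y _ e
      rw [Prod.mk.injEq] at e
      exact Prod.ext (Fin.ext e.1) (Fin.ext e.2)
    · intro y hy
      simp only [Finset.mem_filter, mem_pairsLe] at hy
      exact ⟨(⟨y.1, hy.2.1⟩, ⟨y.2, hy.2.2⟩), by simpa using hy.1, rfl⟩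
  have e1 : ((pairsLe k).filter fun y => N ≤ y.1).card = (pairsLe (k - N)).card := by
    refine Finset.card_nbij' (fun y => (y.1 - N, y.2)) (fun y => (y.1 + N, y.2)) ?_ ?_ ?_ ?_ <;>
    · intro y hy
      simp only [Finset.coe_filter, Set.mem_ofPred_eq, mem_pairsLe, Finset.mem_coe] at hy ⊢
      first
      | omega
      | exact Prod.ext (by simp only; omega) rfl
  have e2 : ((pairsLe k).filter fun y => N ≤ y.2).card = (pairsLe (k - N)).card := by
    refine Finset.card_nbij' (fun y => (y.1, y.2 - N)) (fun y => (y.1, y.2 + N)) ?_ ?_ ?_ ?_ <;>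
    · intro y hy
      simp only [Finset.coe_filter, Set.mem_ofPred_eq, mem_pairsLe, Finset.mem_coe] at hy ⊢
      first
      | omega
      | exact Prod.ext rfl (by simp only; omega)
  have e3 : pairsLe k = (pairsLe k).filter (fun y => y.1 < N ∧ y.2 < N) ∪
      ((pairsLe k).filter (fun y => N ≤ y.1) ∪ (pairsLe k).filter fun y => N ≤ y.2) := by
    ext y
    simp only [Finset.mem_union, Finset.mem_filter]
    constructor
    · intro hy
      rcases lt_or_ge y.1 N with h1 | h1 <;> rcases lt_or_ge y.2 N with h2 | h2 <;> simp [*]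
    · tauto
  rw [← card_pairsLe k, ← card_pairsLe (k - N), e3, Finset.card_union_of_disjoint,
    Finset.card_union_of_disjoint, e0, e1, e2]
  · ring
  · rw [Finset.disjoint_left]
    intro y
    simp only [Finset.mem_filter, mem_pairsLe]
    omega
  · rw [Finset.disjoint_left]
    intro y
    simp only [Finset.mem_union, Finset.mem_filter]
    omega

theorem card_filter_eq_pairsLe {N x : ℕ} {p : Fin N × Fin N → Prop} [DecidablePred p]
    (f : Fin N × Fin N → ℕ × ℕ) (h1 : ∀ y, p y → (f y).1 + (f y).2 ≤ x)
    (h2 : ∀ y z, p y → p z → f y = f z → y = z)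
    (h3 : ∀ a b, a + b ≤ x → ∃ y, p y ∧ f y = (a, b)) :
    (Finset.univ.filter p).card = (x + 2).choose 2 := by
  rw [← card_pairsLe]
  refine Finset.card_bij (fun y _ => f y) ?_ ?_ ?_
  · intro y hy
    rw [Finset.mem_filter] at hy
    exact mem_pairsLe.2 (h1 y hy.2)
  · intro y hy z hz e
    rw [Finset.mem_filter] at hy hz
    exact h2 y z hy.2 hz.2 e
  · rintro ⟨a, b⟩ hab
    obtain ⟨y, hy, e⟩ := h3 a b (mem_pairsLe.1 hab)
    exact ⟨y, by simpa using hy, e⟩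

/-! ### Summing up the (≤ k)-edges -/

namespace IsThreeChainConfig

variable {m : ℕ} {o : Plane} {P : Fin 3 → Fin (4 * m) → Plane} (h : IsThreeChainConfig m o P)
include h

open Classical in
theorem numLeEdges_eq_sum_chains (k : ℕ) : numLeEdges (pointSet P) k = ∑ t, ∑ s,
    (Finset.univ.filter fun x : Fin (4 * m) × Fin (4 * m) => P t x.1 ≠ P s x.2 ∧
      rightCount (pointSet P) (P t x.1) (P s x.2) ≤ k).card := by
  rw [numLeEdges_eq, h.sum_pointSet]
  refine Finset.sum_congr rfl fun t _ => ?_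
  simp_rw [h.sum_pointSet]
  rw [Finset.sum_comm]
  refine Finset.sum_congr rfl fun s _ => ?_
  rw [Finset.card_filter, Fintype.sum_prod_type]

variable (t : Fin 3) {k : ℕ}

/-- For the pairs not covered by `rightCount_next`, both sides fail: there i + j is at least `5 * m`
too. -/
theorem isLeEdge_next_iff (hk2 : k < 5 * m) (i j : Fin (4 * m)) :
    (P t i ≠ P (t + 1) j ∧ rightCount (pointSet P) (P t i) (P (t + 1) j) ≤ k) ↔
      (i : ℕ) + j ≤ k := by
  have hne : P t i ≠ P (t + 1) j := fun e =>
    Fin.self_ne_add_one_three t (congrArg Prod.fst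
      (@IsThreeChainConfig.injective _ _ _ h (t, i) (t + 1, j) e))
  by_cases hij : (i : ℕ) < 3 * m ∨ (j : ℕ) < 2 * m
  · rw [h.rightCount_next t hij]
    tauto
  · have := h.le_rightCount_next (i := i) (j := j) t (by omega) (by omega)
    constructor
    · rintro ⟨-, h1⟩; omega
    · intro h1; omega

theorem isLeEdge_rest_iff (hk2 : k < 5 * m) (i j : Fin (4 * m)) :
    (P t i ≠ P (t + 2) j ∧ rightCount (pointSet P) (P t i) (P (t + 2) j) ≤ k) ↔
      (i : ℕ) < 3 * m ∧ 3 * m ≤ (j : ℕ) ∧ (4 * m - 1 - j) + (3 * m - 1 - i) + 4 * m ≤ k := by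
  have hne : P t i ≠ P (t + 2) j := fun e =>
    Fin.add_two_ne_self_three t (congrArg Prod.fst
      (@IsThreeChainConfig.injective _ _ _ h (t, i) (t + 2, j) e)).symm
  by_cases hij : 3 * m ≤ (j : ℕ) ∧ 2 * m ≤ (i : ℕ) ∧ (i : ℕ) < 3 * m
  · have := h.rightCount_prev (t + 2) hij.1 hij.2.1 hij.2.2
    rw [Fin.add_two_add_one_three] at this
    rw [this]
    tauto
  · have := h.le_rightCount_prev (i := j) (j := i) (t + 2) (by omega)
    rw [Fin.add_two_add_one_three] at this
    constructor
    · rintro ⟨-, h1⟩; omega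
    · rintro ⟨h1, h2, h3⟩; omega

/-- The order of the indices need not be stated: `k < 5 * m` forces j ≥ i + 2m in the first
alternative (A to B) and i ≥ j + 3m in the second (C to A). -/
theorem isLeEdge_own_iff (hk2 : k < 5 * m) (i j : Fin (4 * m)) :
    (P t i ≠ P t j ∧ rightCount (pointSet P) (P t i) (P t j) ≤ k) ↔
      ((j : ℕ) < 3 * m ∧ i + (3 * m - 1 - j) + 4 * m ≤ k) ∨
      (3 * m ≤ (i : ℕ) ∧ (j : ℕ) + (4 * m - 1 - i) + 4 * m ≤ k) := by
  have hne : i ≠ j → P t i ≠ P t j := fun hij e =>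
    hij (congrArg Prod.snd (@IsThreeChainConfig.injective _ _ _ h (t, i) (t, j) e))
  rcases lt_trichotomy i j with hij | rfl | hij
  · have := hne hij.ne
    have hij' := Fin.lt_def.1 hij
    rcases lt_or_ge (j : ℕ) (3 * m) with hj | hj
    · rw [h.rightCount_inward_AB t hij hj]
      constructor
      · rintro ⟨-, h1⟩; omega
      · intro h1; exact ⟨this, by omega⟩
    · have := h.le_rightCount_inward t hij hj
      constructor
      · rintro ⟨-, h1⟩; omega
      · intro h1; omega
  · constructor
    · rintro ⟨h1, -⟩; exact absurd rfl h1
    · intro h1; omega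
  · have := hne hij.ne'
    have hij' := Fin.lt_def.1 hij
    by_cases hex : (j : ℕ) < 2 * m ∧ 3 * m ≤ (i : ℕ)
    · rw [h.rightCount_outward_C_A t hex.1 hex.2]
      constructor
      · rintro ⟨-, h1⟩; omega
      · intro h1; exact ⟨this, by omega⟩
    · have := h.le_rightCount_outward t hij (by omega)
      constructor
      · rintro ⟨-, h1⟩; omega
      · intro h1; omega

theorem numLeEdges_pointSet (hk : 4 * m ≤ k) (hk2 : k < 5 * m) :
    numLeEdges (pointSet P) k = 3 * (k + 2).choose 2 + 3 * (k - 4 * m + 2).choose 2 := by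
  classical
  rw [h.numLeEdges_eq_sum_chains]
  have key : ∀ t : Fin 3, ∑ s,
      (Finset.univ.filter fun x : Fin (4 * m) × Fin (4 * m) => P t x.1 ≠ P s x.2 ∧
        rightCount (pointSet P) (P t x.1) (P s x.2) ≤ k).card =
        (k + 2).choose 2 + (k - 4 * m + 2).choose 2 := by
    intro t
    rw [Fin.sum_three_shift _ t]
    simp_rw [h.isLeEdge_own_iff t hk2, h.isLeEdge_next_iff t hk2, h.isLeEdge_rest_iff t hk2]
    have e1 := card_filter_add_le hk (by omega)
    have e2 : (Finset.univ.filter fun x : Fin (4 * m) × Fin (4 * m) => (x.1 : ℕ) < 3 * m ∧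
        3 * m ≤ (x.2 : ℕ) ∧ (4 * m - 1 - x.2) + (3 * m - 1 - x.1) + 4 * m ≤ k).card =
        (k - 4 * m + 2).choose 2 := by
      apply card_filter_eq_pairsLe fun x => (4 * m - 1 - x.2, 3 * m - 1 - x.1)
      · intro y hy; simp only; omega
      · rintro ⟨y1, y2⟩ ⟨z1, z2⟩ hy hz e
        simp only [Prod.mk.injEq, Fin.ext_iff] at *; omega
      · intro a b hab
        -- Since `a` and `b` are at most `k - 4 * m < m`, these indices stay inside B and C.
        refine ⟨(⟨3 * m - 1 - b, by omega⟩, ⟨4 * m - 1 - a, by omega⟩), ?_, ?_⟩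
        · simp only; omega
        · simp only [Prod.mk.injEq]; omega
    have e3 : (Finset.univ.filter fun x : Fin (4 * m) × Fin (4 * m) => (x.2 : ℕ) < 3 * m ∧
        x.1 + (3 * m - 1 - x.2) + 4 * m ≤ k).card = (k - 4 * m + 2).choose 2 := by
      apply card_filter_eq_pairsLe fun x => (x.1, 3 * m - 1 - x.2)
      · intro y hy; simp only; omega
      · rintro ⟨y1, y2⟩ ⟨z1, z2⟩ hy hz e
        simp only [Prod.mk.injEq, Fin.ext_iff] at *; omega
      · intro a b hab
        refine ⟨(⟨a, by omega⟩, ⟨3 * m - 1 - b, by omega⟩), ?_, ?_⟩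
        · simp only; omega
        · simp only [Prod.mk.injEq, true_and]; omega
    have e4 : (Finset.univ.filter fun x : Fin (4 * m) × Fin (4 * m) => 3 * m ≤ (x.1 : ℕ) ∧
        x.2 + (4 * m - 1 - x.1) + 4 * m ≤ k).card = (k - 4 * m + 2).choose 2 := by
      apply card_filter_eq_pairsLe fun x => (x.2, 4 * m - 1 - x.1)
      · intro y hy; simp only; omega
      · rintro ⟨y1, y2⟩ ⟨z1, z2⟩ hy hz e
        simp only [Prod.mk.injEq, Fin.ext_iff] at *; omega
      · intro a b hab
        refine ⟨(⟨4 * m - 1 - b, by omega⟩, ⟨a, by omega⟩), ?_, ?_⟩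
        · simp only; omega
        · simp only [Prod.mk.injEq, true_and]; omega
    rw [Finset.filter_or, Finset.card_union_of_disjoint, e2, e3, e4]
    -- Here `e1` gives the deficit 2D, and the three families `e2`, `e3`, `e4` return 3D.
    · omega
    · rw [Finset.disjoint_left]
      intro x
      simp only [Finset.mem_filter, Finset.mem_univ, true_and]
      omega
  simp_rw [key]
  rw [Finset.sum_const, Finset.card_univ, Fintype.card_fin, smul_eq_mul]
  ring

end IsThreeChainConfig

theorem sum_Icc_three_mul (N x : ℕ) :
    ∑ j ∈ Finset.Icc N (N + x), (3 * (j : ℤ) - 3 * N + 3) = 3 * ((x + 2).choose 2 : ℤ) := by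
  induction x with
  | zero => simp
  | succ x ih =>
    rw [← add_assoc, Finset.sum_Icc_succ_top (by omega), ih, Nat.choose_succ_succ' (x + 2) 1,
      Nat.choose_one_right]
    push_cast
    ring

/-! ### Coordinates adapted to the rotation -/

/-- The point of the plane with coordinates `z` in the basis `1`, `exp (2πi/3)`. -/
noncomputable def ofTriCoord (z : ℝ × ℝ) : Plane := !₂[z.1 - z.2 / 2, √3 / 2 * z.2]

/-- The rotation by `t * 120` degrees in coordinates with respect to `1`, `exp (2πi/3)`. -/
def turn (t : Fin 3) (z : ℝ × ℝ) : ℝ × ℝ :=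
  match t with
  | 0 => z
  | 1 => (-z.2, z.1 - z.2)
  | 2 => (z.2 - z.1, -z.1)

/-- The signed area in coordinates with respect to `1`, `exp (2πi/3)`, up to a positive factor. -/
def triArea (p q r : ℝ × ℝ) : ℝ :=
  (q.1 - p.1) * (r.2 - p.2) - (q.2 - p.2) * (r.1 - p.1)

/-- The squared norm in coordinates with respect to `1`, `exp (2πi/3)`. -/
def triNormSq (z : ℝ × ℝ) : ℝ := z.1 ^ 2 - z.1 * z.2 + z.2 ^ 2

theorem area2_ofTriCoord (p q r : ℝ × ℝ) :
    area2 (ofTriCoord p) (ofTriCoord q) (ofTriCoord r) = √3 / 2 * triArea p q r := by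
  simp [area2, ofTriCoord, triArea]
  ring

theorem isLeft_ofTriCoord {p q r : ℝ × ℝ} :
    IsLeft (ofTriCoord p) (ofTriCoord q) (ofTriCoord r) ↔ 0 < triArea p q r := by
  rw [IsLeft, area2_ofTriCoord]
  exact mul_pos_iff_of_pos_left (by positivity)

theorem isRight_ofTriCoord {p q r : ℝ × ℝ} :
    IsRight (ofTriCoord p) (ofTriCoord q) (ofTriCoord r) ↔ triArea p q r < 0 := by
  rw [IsRight, area2_ofTriCoord]
  have : 0 < √3 / 2 := by positivity
  constructor
  · intro h; exact (pos_iff_neg_of_mul_neg h).1 this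
  · intro h; exact mul_neg_of_pos_of_neg this h

theorem dist_ofTriCoord_zero (z : ℝ × ℝ) : dist (ofTriCoord z) 0 = √(triNormSq z) := by
  rw [EuclideanSpace.dist_eq]
  congr 1
  have h3 : √3 ^ 2 = 3 := Real.sq_sqrt (by norm_num)
  simp [ofTriCoord, triNormSq, sq_abs, mul_pow, div_pow, h3]
  ring

theorem rot120_ofTriCoord (z : ℝ × ℝ) : rot120 0 (ofTriCoord z) = ofTriCoord (turn 1 z) := by
  have h3 : √3 * √3 = 3 := Real.mul_self_sqrt (by norm_num)
  ext i
  fin_cases i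
  · simp [rot120, ofTriCoord, turn]
    linear_combination (-z.2 / 4) * h3
  · simp [rot120, ofTriCoord, turn]
    ring

theorem turn_add (t s : Fin 3) (z : ℝ × ℝ) : turn (t + s) z = turn t (turn s z) := by
  fin_cases t <;> fin_cases s <;> simp [turn] <;> ring

theorem triArea_turn (t : Fin 3) (p q r : ℝ × ℝ) :
    triArea (turn t p) (turn t q) (turn t r) = triArea p q r := by
  fin_cases t <;> simp [turn, triArea] <;> ring

theorem triNormSq_turn (t : Fin 3) (z : ℝ × ℝ) : triNormSq (turn t z) = triNormSq z := by
  fin_cases t <;> simp [turn, triNormSq] <;> ring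

/-- A flat parabola that carries the subchains `A` and `B`. -/
noncomputable def curveAB (τ : ℝ) : ℝ × ℝ := (3 * τ, τ + τ ^ 2 / 100)

/-- A flat parabola that carries the subchain `C`. -/
def curveC (u : ℝ) : ℝ × ℝ := (1 - 3 * u + u ^ 2, -2 * u)

/-- The parameters on `curveAB` that are used for the subchain `A`. -/
def RangeA (τ : ℝ) : Prop := 2 ≤ τ ∧ τ ≤ 3

/-- The parameters on `curveAB` that are used for the subchain `B`. -/
def RangeB (τ : ℝ) : Prop := 3 / 5 ≤ τ ∧ τ ≤ 13 / 20

/-- The parameters on `curveAB` that are used for the subchains `A` and `B`. -/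
def RangeAB (τ : ℝ) : Prop := 3 / 5 ≤ τ ∧ τ ≤ 3

/-- The parameters on `curveC` that are used for the subchain `C`. -/
def RangeC (u : ℝ) : Prop := 0 ≤ u ∧ u ≤ 1 / 50

/-! ### Polynomial inequalities for the two parabolas -/

section Curves

variable {τ τ' η β u u' w : ℝ}

theorem triArea_curveAB (τ τ' : ℝ) (z : ℝ × ℝ) : triArea (curveAB τ) (curveAB τ') z =
    (τ' - τ) * (3 * z.2 - (1 + (τ + τ') / 100) * z.1 + 3 * (τ * τ') / 100) := by
  simp only [triArea, curveAB]; ring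

theorem triArea_curveC (u u' : ℝ) (z : ℝ × ℝ) : triArea (curveC u) (curveC u') z =
    (u' - u) * ((-3 + (u + u')) * z.2 + 2 * z.1 - 2 + 2 * (u * u')) := by
  simp only [triArea, curveC]; ring

/-- After removal of the factor τ' - τ, the secant depends only on the sum and product of the
parameters. Treating these as independent in a box is enough. -/
theorem triArea_curveAB_neg {z : ℝ × ℝ} (hτ : RangeAB τ) (hτ' : RangeAB τ') (h : τ' < τ)
    (hz : ∀ s r : ℝ, 6 / 5 ≤ s → s ≤ 6 → 0 ≤ r → r ≤ 9 →
      0 < 3 * z.2 - (1 + s / 100) * z.1 + 3 * r / 100) :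
    triArea (curveAB τ) (curveAB τ') z < 0 := by
  obtain ⟨a1, a2⟩ := hτ
  obtain ⟨b1, b2⟩ := hτ'
  rw [triArea_curveAB]
  exact mul_neg_of_neg_of_pos (by linarith)
    (hz _ _ (by linarith) (by linarith) (by nlinarith) (by nlinarith))

theorem triArea_curveAB_pos {z : ℝ × ℝ} (hτ : RangeAB τ) (hτ' : RangeAB τ') (h : τ' < τ)
    (hz : ∀ s r : ℝ, 6 / 5 ≤ s → s ≤ 6 → 0 ≤ r → r ≤ 9 →
      3 * z.2 - (1 + s / 100) * z.1 + 3 * r / 100 < 0) :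
    0 < triArea (curveAB τ) (curveAB τ') z := by
  obtain ⟨a1, a2⟩ := hτ
  obtain ⟨b1, b2⟩ := hτ'
  rw [triArea_curveAB]
  exact mul_pos_of_neg_of_neg (by linarith)
    (hz _ _ (by linarith) (by linarith) (by nlinarith) (by nlinarith))

theorem curveAB_convex (h : τ' < τ) (h' : η < τ') :
    triArea (curveAB τ) (curveAB τ') (curveAB η) < 0 := by
  have : triArea (curveAB τ) (curveAB τ') (curveAB η)
      = -(3 / 100 * ((τ - τ') * (τ - η) * (τ' - η))) := by
    simp only [triArea, curveAB]; ring
  rw [this, neg_lt_zero]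
  have := mul_pos (mul_pos (sub_pos.2 h) (sub_pos.2 (h'.trans h))) (sub_pos.2 h')
  linarith

theorem curveC_convex (h : u < u') (h' : u' < w) :
    0 < triArea (curveC u) (curveC u') (curveC w) := by
  have : triArea (curveC u) (curveC u') (curveC w) = 2 * ((u' - u) * (w - u) * (w - u')) := by
    simp only [triArea, curveC]; ring
  rw [this]
  have := mul_pos (mul_pos (sub_pos.2 h) (sub_pos.2 (h.trans h'))) (sub_pos.2 h')
  linarith

theorem curveAB_next_AB (hτ : RangeAB τ) (hτ' : RangeAB τ') (h : τ' < τ) (hη : RangeAB η) :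
    triArea (curveAB τ) (curveAB τ') (turn 1 (curveAB η)) < 0 := by
  refine triArea_curveAB_neg hτ hτ' h fun s r s1 s2 r1 r2 => ?_
  obtain ⟨c1, c2⟩ := hη
  simp only [turn, curveAB]
  have : 0 ≤ s * η := by positivity
  have : 0 ≤ s * η ^ 2 := by positivity
  nlinarith

theorem curveAB_next_C (hτ : RangeAB τ) (hτ' : RangeAB τ') (h : τ' < τ) (hu : RangeC u) :
    triArea (curveAB τ) (curveAB τ') (turn 1 (curveC u)) < 0 := by
  refine triArea_curveAB_neg hτ hτ' h fun s r s1 s2 r1 r2 => ?_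
  obtain ⟨c1, c2⟩ := hu
  simp only [turn, curveC]
  have : s * u ≤ 6 * u := by gcongr
  nlinarith

theorem curveAB_rest_AB (hτ : RangeAB τ) (hτ' : RangeAB τ') (h : τ' < τ) (hη : RangeAB η) :
    0 < triArea (curveAB τ) (curveAB τ') (turn 2 (curveAB η)) := by
  refine triArea_curveAB_pos hτ hτ' h fun s r s1 s2 r1 r2 => ?_
  obtain ⟨c1, c2⟩ := hη
  simp only [turn, curveAB]
  have : s * η ≤ 6 * η := by gcongr
  have : 0 ≤ s * η ^ 2 := by positivity
  nlinarith

theorem curveAB_rest_C (hτ : RangeAB τ) (hτ' : RangeAB τ') (h : τ' < τ) (hu : RangeC u) :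
    0 < triArea (curveAB τ) (curveAB τ') (turn 2 (curveC u)) := by
  refine triArea_curveAB_pos hτ hτ' h fun s r s1 s2 r1 r2 => ?_
  obtain ⟨c1, c2⟩ := hu
  simp only [turn, curveC]
  have : 0 ≤ s * u := by positivity
  have : u ^ 2 ≤ 1 / 2500 := by nlinarith
  have : s * u ^ 2 ≤ 6 * (1 / 2500) := by gcongr
  nlinarith

theorem curveAB_own_C (hτ : RangeAB τ) (hτ' : RangeAB τ') (h : τ' < τ) (hu : RangeC u) :
    0 < triArea (curveAB τ) (curveAB τ') (curveC u) := by
  refine triArea_curveAB_pos hτ hτ' h fun s r s1 s2 r1 r2 => ?_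
  obtain ⟨c1, c2⟩ := hu
  simp only [curveC]
  have : s * u ≤ 6 * u := by gcongr
  have : 0 ≤ s * u ^ 2 := by positivity
  nlinarith

theorem triArea_curveC_neg {z : ℝ × ℝ} (hu : RangeC u) (hu' : RangeC u') (h : u < u')
    (hz : ∀ s r : ℝ, 0 ≤ s → s ≤ 1 / 25 → 0 ≤ r → r ≤ 1 / 2500 →
      (-3 + s) * z.2 + 2 * z.1 - 2 + 2 * r < 0) :
    triArea (curveC u) (curveC u') z < 0 := by
  obtain ⟨a1, a2⟩ := hu
  obtain ⟨b1, b2⟩ := hu'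
  rw [triArea_curveC]
  exact mul_neg_of_pos_of_neg (by linarith)
    (hz _ _ (by linarith) (by linarith) (by nlinarith) (by nlinarith))

/-- For parameters near 0 the second factor is close to 3τ - 2 - 3τ²/100, with a zero near 0.67, in
the gap between the ranges of B and A. -/
theorem curveC_A (hu : RangeC u) (hu' : RangeC u') (h : u < u') (hτ : RangeA τ) :
    0 < triArea (curveC u) (curveC u') (curveAB τ) := by
  rw [triArea_curveC]
  refine mul_pos (sub_pos.2 h) ?_
  obtain ⟨a1, a2⟩ := hu
  obtain ⟨b1, b2⟩ := hu'
  obtain ⟨c1, c2⟩ := hτ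
  simp only [curveAB]
  have : 0 ≤ u * u' := by positivity
  have : 0 ≤ (u + u') * (τ + τ ^ 2 / 100) := by positivity
  nlinarith

theorem curveC_B (hu : RangeC u) (hu' : RangeC u') (h : u < u') (hτ : RangeB τ) :
    triArea (curveC u) (curveC u') (curveAB τ) < 0 := by
  refine triArea_curveC_neg hu hu' h fun s r s1 s2 r1 r2 => ?_
  obtain ⟨c1, c2⟩ := hτ
  simp only [curveAB]
  have : τ ^ 2 ≤ (13 / 20) ^ 2 := by gcongr
  have : s * (τ + τ ^ 2 / 100) ≤ 1 / 25 * (13 / 20 + (13 / 20) ^ 2 / 100) := by gcongr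
  nlinarith

theorem curveC_next (hu : RangeC u) (hu' : RangeC u') (h : u < u') (hw : RangeC w) :
    triArea (curveC u) (curveC u') (turn 1 (curveC w)) < 0 := by
  refine triArea_curveC_neg hu hu' h fun s r s1 s2 r1 r2 => ?_
  obtain ⟨c1, c2⟩ := hw
  simp only [turn, curveC]
  have : w ^ 2 ≤ 1 / 2500 := by nlinarith
  have : 0 ≤ s * w := by positivity
  have : s * w ^ 2 ≤ 1 / 25 * (1 / 2500) := by gcongr
  nlinarith

theorem curveC_rest (hu : RangeC u) (hu' : RangeC u') (h : u < u') (hw : RangeC w) :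
    triArea (curveC u) (curveC u') (turn 2 (curveC w)) < 0 := by
  refine triArea_curveC_neg hu hu' h fun s r s1 s2 r1 r2 => ?_
  obtain ⟨c1, c2⟩ := hw
  simp only [turn, curveC]
  have : w ^ 2 ≤ 1 / 2500 := by nlinarith
  have : s * w ≤ 1 / 25 * (1 / 50) := by gcongr
  have : 0 ≤ s * w ^ 2 := by positivity
  nlinarith

theorem triArea_curveC_turn (u w τ : ℝ) :
    triArea (curveC u) (turn 2 (curveC w)) (curveAB τ) =
      τ - 1 - τ ^ 2 / 50 - 4 * u + (w - w ^ 2 + 3 * u - u ^ 2) * (τ + τ ^ 2 / 100 + 2 * u)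
        + (3 * u - u ^ 2) - (3 * w - w ^ 2 + 2 * u) * (3 * τ - 1 + (3 * u - u ^ 2)) := by
  simp only [triArea, turn, curveC, curveAB]; ring

theorem RangeC.quadratic_bounds (hu : RangeC u) :
    0 ≤ u - u ^ 2 ∧ u - u ^ 2 ≤ 1 / 50 ∧ 0 ≤ 3 * u - u ^ 2 ∧ 3 * u - u ^ 2 ≤ 3 / 50 := by
  obtain ⟨a1, a2⟩ := hu
  refine ⟨?_, ?_, ?_, ?_⟩ <;> nlinarith

/-- At u = w = 0 the area is τ - 1 - τ²/50, whose zero near 1.02 also lies in the gap between B and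
A; the other terms are small perturbations or help. -/
theorem curveC_C_A (hu : RangeC u) (hw : RangeC w) (hτ : RangeA τ) :
    0 < triArea (curveC u) (turn 2 (curveC w)) (curveAB τ) := by
  rw [triArea_curveC_turn]
  obtain ⟨-, -, p3, p4⟩ := hu.quadratic_bounds
  obtain ⟨q1, -, q3, q4⟩ := hw.quadratic_bounds
  obtain ⟨a1, a2⟩ := hu
  obtain ⟨c1, c2⟩ := hτ
  have h1 : 0 ≤ (w - w ^ 2 + 3 * u - u ^ 2) * (τ + τ ^ 2 / 100 + 2 * u) :=
    mul_nonneg (by linarith) (by positivity)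
  have h2 : (3 * w - w ^ 2 + 2 * u) * (3 * τ - 1 + (3 * u - u ^ 2)) ≤
      1 / 10 * (3 * τ - 1 + 3 / 50) :=
    mul_le_mul (by linarith) (by linarith) (by linarith) (by norm_num)
  nlinarith

theorem curveC_C_B (hu : RangeC u) (hw : RangeC w) (hτ : RangeB τ) :
    triArea (curveC u) (turn 2 (curveC w)) (curveAB τ) < 0 := by
  rw [triArea_curveC_turn]
  obtain ⟨-, -, p3, p4⟩ := hu.quadratic_bounds
  obtain ⟨q1, q2, q3, q4⟩ := hw.quadratic_bounds
  obtain ⟨a1, a2⟩ := hu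
  obtain ⟨c1, c2⟩ := hτ
  have h1 : (w - w ^ 2 + 3 * u - u ^ 2) * (τ + τ ^ 2 / 100 + 2 * u) ≤ 2 / 25 * 1 :=
    mul_le_mul (by linarith) (by nlinarith) (by positivity) (by norm_num)
  have h2 : 0 ≤ (3 * w - w ^ 2 + 2 * u) * (3 * τ - 1 + (3 * u - u ^ 2)) :=
    mul_nonneg (by linarith) (by linarith)
  nlinarith

theorem curveAB_triangle (hβ : RangeB β) (hu : RangeC u) (s : Fin 3) :
    0 < triArea (curveAB β) (turn 1 (curveAB β)) (turn s (curveC u)) := by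
  obtain ⟨a1, a2⟩ := hβ
  obtain ⟨c1, c2⟩ := hu
  obtain ⟨y, hy⟩ : ∃ y, y = β + β ^ 2 / 100 := ⟨_, rfl⟩
  have y1 : β ≤ y := by rw [hy]; nlinarith
  have y2 : y ≤ β + 1 / 200 := by rw [hy]; nlinarith
  have hu2 : u ^ 2 ≤ 1 / 2500 := by nlinarith
  fin_cases s <;> simp only [triArea, turn, curveAB, curveC, ← hy]
  all_goals nlinarith [mul_nonneg c1 (sub_nonneg.2 a1), mul_nonneg c1 (sub_nonneg.2 y1),
    mul_nonneg (sub_nonneg.2 a1) (sub_nonneg.2 a2), mul_nonneg (sub_nonneg.2 y1) (sub_nonneg.2 y2)]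

theorem triNormSq_curveAB_lt (hτ : RangeAB τ) (hτ' : RangeAB τ') (h : τ' < τ) :
    triNormSq (curveAB τ') < triNormSq (curveAB τ) := by
  obtain ⟨a1, a2⟩ := hτ
  obtain ⟨b1, b2⟩ := hτ'
  have : triNormSq (curveAB τ) - triNormSq (curveAB τ') = (τ - τ') * (7 * (τ + τ')
      - (τ ^ 2 + τ * τ' + τ' ^ 2) / 100 + (τ + τ') * (τ ^ 2 + τ' ^ 2) / 10000) := by
    simp only [triNormSq, curveAB]; ring
  rw [← sub_pos, this]
  refine mul_pos (sub_pos.2 h) ?_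
  have : 0 ≤ (τ + τ') * (τ ^ 2 + τ' ^ 2) := by positivity
  nlinarith

theorem triNormSq_curveC_lt (hu : RangeC u) (hu' : RangeC u') (h : u < u') :
    triNormSq (curveC u') < triNormSq (curveC u) := by
  obtain ⟨a1, a2⟩ := hu
  obtain ⟨b1, b2⟩ := hu'
  have : triNormSq (curveC u) - triNormSq (curveC u') = (u' - u) * (4 - 9 * (u + u')
      + 4 * (u ^ 2 + u * u' + u' ^ 2) - (u + u') * (u ^ 2 + u' ^ 2)) := by
    simp only [triNormSq, curveC]; ring
  rw [← sub_pos, this]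
  refine mul_pos (sub_pos.2 h) ?_
  have : 0 ≤ u * u' := by positivity
  have : u ^ 2 ≤ 1 := by nlinarith
  have : u' ^ 2 ≤ 1 := by nlinarith
  nlinarith

/-- The unit circle separates: C starts on it at (1, 0) and moves inwards. -/
theorem triNormSq_curveC_lt_curveAB (hu : RangeC u) (hτ : RangeAB τ) :
    triNormSq (curveC u) < triNormSq (curveAB τ) := by
  obtain ⟨a1, a2⟩ := hu
  obtain ⟨b1, b2⟩ := hτ
  have e1 : triNormSq (curveC u) ≤ 1 := by
    simp only [triNormSq, curveC]; nlinarith [mul_nonneg a1 a1, mul_nonneg (mul_nonneg a1 a1) a1]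
  have e2 : 1 < triNormSq (curveAB τ) := by
    have : triNormSq (curveAB τ) = τ ^ 2 * (7 - τ / 100 + τ ^ 2 / 10000) := by
      simp only [triNormSq, curveAB]; ring
    rw [this]
    nlinarith
  linarith

end Curves

/-! ### Choice of the points on the curves -/

/-- The parameters on `curveAB` of the points of the subchains `A` and `B`. -/
noncomputable def paramAB (m i : ℕ) : ℝ :=
  if i < 2 * m then 3 - i / (2 * m) else 3 / 4 - i / (20 * m)

/-- The parameters on `curveC` of the points of the subchain `C`. -/
noncomputable def paramC (m i : ℕ) : ℝ := (i - 3 * m) / (50 * m)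

/-- The points of a chain, in coordinates with respect to `1`, `exp (2πi/3)`. -/
noncomputable def chainPoint (m i : ℕ) : ℝ × ℝ :=
  if i < 3 * m then curveAB (paramAB m i) else curveC (paramC m i)

section Params

variable {m i j : ℕ}

theorem rangeA_paramAB (hi : i < 2 * m) : RangeA (paramAB m i) := by
  have hm : (0 : ℝ) < m := by exact_mod_cast (by omega : 0 < m)
  have hi' : (i : ℝ) < 2 * m := by exact_mod_cast hi
  have h1 : (i : ℝ) / (2 * m) ≤ 1 := by rw [div_le_one (by positivity)]; exact hi'.le
  have h2 : 0 ≤ (i : ℝ) / (2 * m) := by positivity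
  rw [paramAB, if_pos hi]
  constructor <;> linarith

theorem rangeB_paramAB (hi : 2 * m ≤ i) (hi3 : i < 3 * m) : RangeB (paramAB m i) := by
  have hm : (0 : ℝ) < m := by exact_mod_cast (by omega : 0 < m)
  have hi' : (2 : ℝ) * m ≤ i := by exact_mod_cast hi
  have hi3' : (i : ℝ) < 3 * m := by exact_mod_cast hi3
  have h1 : (i : ℝ) / (20 * m) ≤ 3 / 20 := by rw [div_le_iff₀ (by positivity)]; linarith
  have h2 : 1 / 10 ≤ (i : ℝ) / (20 * m) := by rw [le_div_iff₀ (by positivity)]; linarith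
  rw [paramAB, if_neg (by omega)]
  constructor <;> linarith

theorem rangeAB_paramAB (hi : i < 3 * m) : RangeAB (paramAB m i) := by
  rcases lt_or_ge i (2 * m) with h | h
  · have := rangeA_paramAB h
    exact ⟨by linarith [this.1], this.2⟩
  · have := rangeB_paramAB h hi
    exact ⟨this.1, by linarith [this.2]⟩

theorem rangeC_paramC (hi : 3 * m ≤ i) (hi4 : i < 4 * m) : RangeC (paramC m i) := by
  have hm : (0 : ℝ) < m := by exact_mod_cast (by omega : 0 < m)
  have hi' : (3 : ℝ) * m ≤ i := by exact_mod_cast hi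
  have hi4' : (i : ℝ) < 4 * m := by exact_mod_cast hi4
  constructor
  · exact div_nonneg (by linarith) (by positivity)
  · rw [paramC, div_le_iff₀ (by positivity)]; linarith

theorem paramAB_lt (hij : i < j) (hj : j < 3 * m) : paramAB m j < paramAB m i := by
  have hm : (0 : ℝ) < m := by exact_mod_cast (by omega : 0 < m)
  have hij' : (i : ℝ) < j := by exact_mod_cast hij
  rcases lt_or_ge j (2 * m) with h | h
  · rw [paramAB, paramAB, if_pos h, if_pos (by omega)]
    gcongr
  · rcases lt_or_ge i (2 * m) with h' | h'
    · linarith [(rangeA_paramAB h').1, (rangeB_paramAB h hj).2]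
    · rw [paramAB, paramAB, if_neg (by omega), if_neg (by omega)]
      gcongr

theorem paramC_lt (hm : 0 < m) (hij : i < j) : paramC m i < paramC m j := by
  have hm : (0 : ℝ) < m := by exact_mod_cast hm
  have hij' : (i : ℝ) < j := by exact_mod_cast hij
  unfold paramC
  gcongr

theorem chainPoint_AB (hi : i < 3 * m) : chainPoint m i = curveAB (paramAB m i) := if_pos hi

theorem chainPoint_C (hi : 3 * m ≤ i) : chainPoint m i = curveC (paramC m i) :=
  if_neg (by omega)

theorem triNormSq_chainPoint_lt (hij : i < j) (hj : j < 4 * m) :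
    triNormSq (chainPoint m j) < triNormSq (chainPoint m i) := by
  rcases lt_or_ge j (3 * m) with h | h
  · rw [chainPoint_AB h, chainPoint_AB (by omega)]
    exact triNormSq_curveAB_lt (rangeAB_paramAB (by omega)) (rangeAB_paramAB h) (paramAB_lt hij h)
  rw [chainPoint_C h]
  rcases lt_or_ge i (3 * m) with h' | h'
  · rw [chainPoint_AB h']
    exact triNormSq_curveC_lt_curveAB (rangeC_paramC h hj) (rangeAB_paramAB h')
  · rw [chainPoint_C h']
    exact triNormSq_curveC_lt (rangeC_paramC h' (by omega)) (rangeC_paramC h hj)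
      (paramC_lt (by omega) hij)

theorem triNormSq_chainPoint_le (hij : i ≤ j) (hj : j < 4 * m) :
    triNormSq (chainPoint m j) ≤ triNormSq (chainPoint m i) := by
  rcases hij.eq_or_lt with rfl | h
  · exact le_rfl
  · exact (triNormSq_chainPoint_lt h hj).le

end Params

/-! ### Existence of configurations and the final statement -/

/-- A point of a set at maximal distance from some point is an extreme point of the convex hull. -/
theorem mem_extremePoints_convexHull_of_dist_le {E : Type*} [NormedAddCommGroup E]
    [NormedSpace ℝ E] [StrictConvexSpace ℝ E] {s : Set E} {x o : E} (hx : x ∈ s) (hxo : x ≠ o)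
    (h : ∀ y ∈ s, dist y o ≤ dist x o) : x ∈ (convexHull ℝ s).extremePoints ℝ := by
  have hsub : convexHull ℝ s ⊆ Metric.closedBall o (dist x o) :=
    convexHull_min (fun y hy => h y hy) (convex_closedBall _ _)
  exact inter_extremePoints_subset_extremePoints_of_subset hsub
    ⟨subset_convexHull ℝ s hx,
      StrictConvexSpace.sphere_subset_extremePoints_closedBall o (dist_ne_zero.2 hxo) rfl⟩

theorem exists_isThreeChainConfig (m : ℕ) :
    ∃ (o : Plane) (P : Fin 3 → Fin (4 * m) → Plane), IsThreeChainConfig m o P := by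
  refine ⟨0, fun t i => ofTriCoord (turn t (chainPoint m i)), ?_⟩
  constructor
  case symmetric =>
    intro t i
    rw [rot120_ofTriCoord, ← turn_add, add_comm]
  case hull_vertex =>
    intro t i hi
    refine mem_extremePoints_convexHull_of_dist_le (o := 0) ?_ ?_ ?_
    · simp only [pointSet, Finset.coe_image, Finset.coe_univ, Set.image_univ, Set.mem_range]
      exact ⟨(t, i), rfl⟩
    · intro e
      have e' := dist_ofTriCoord_zero (turn t (chainPoint m i))
      have := i.2
      rw [e, dist_self, triNormSq_turn, eq_comm] at e'
      -- The outermost point is not the centre, because the next point is strictly closer to it.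
      have h0 := triNormSq_chainPoint_lt (m := m) (i := i) (j := i + 1) (by omega) (by omega)
      have h1 : 0 ≤ triNormSq (chainPoint m (i + 1)) := by
        unfold triNormSq
        nlinarith [sq_nonneg ((chainPoint m (i + 1)).1 - (chainPoint m (i + 1)).2),
          sq_nonneg ((chainPoint m (i + 1)).1 + (chainPoint m (i + 1)).2)]
      exact (Real.sqrt_pos.2 (h1.trans_lt h0)).ne' e'
    · simp only [pointSet, Finset.coe_image, Finset.coe_univ, Set.image_univ, Set.mem_range]
      rintro _ ⟨⟨s, j⟩, rfl⟩
      rw [dist_ofTriCoord_zero, dist_ofTriCoord_zero, triNormSq_turn, triNormSq_turn]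
      exact Real.sqrt_le_sqrt (triNormSq_chainPoint_le (by omega) j.2)
  case inward =>
    intro t i j hij
    rw [dist_ofTriCoord_zero, dist_ofTriCoord_zero, triNormSq_turn, triNormSq_turn]
    refine Real.sqrt_lt_sqrt ?_ (triNormSq_chainPoint_lt hij j.2)
    unfold triNormSq
    nlinarith [sq_nonneg ((chainPoint m j).1 - (chainPoint m j).2),
      sq_nonneg ((chainPoint m j).1 + (chainPoint m j).2)]
  case convex_AB =>
    intro t i j l hij hjl hl
    unfold InAB at hl
    rw [Fin.lt_def] at hij hjl
    rw [isRight_ofTriCoord, triArea_turn, chainPoint_AB (by omega), chainPoint_AB (by omega),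
      chainPoint_AB hl]
    exact curveAB_convex (paramAB_lt hij (by omega)) (paramAB_lt hjl hl)
  case convex_C =>
    intro t i j l hi hij hjl
    unfold InC at hi
    rw [Fin.lt_def] at hij hjl
    rw [isLeft_ofTriCoord, triArea_turn, chainPoint_C hi, chainPoint_C (by omega),
      chainPoint_C (by omega)]
    exact curveC_convex (paramC_lt (by omega) hij) (paramC_lt (by omega) hjl)
  case line_AB_next =>
    intro t i j l hij hj
    rw [isRight_ofTriCoord, turn_add, triArea_turn, chainPoint_AB (by unfold InAB at hj; omega),
      chainPoint_AB hj]
    have ri := rangeAB_paramAB (lt_trans hij hj)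
    have rj := rangeAB_paramAB hj
    rcases lt_or_ge (l : ℕ) (3 * m) with hl | hl
    · rw [chainPoint_AB hl]
      exact curveAB_next_AB ri rj (paramAB_lt hij hj) (rangeAB_paramAB hl)
    · rw [chainPoint_C hl]
      exact curveAB_next_C ri rj (paramAB_lt hij hj) (rangeC_paramC hl l.2)
  case line_AB_C =>
    intro t i j l hij hj hl
    rw [isLeft_ofTriCoord, triArea_turn, chainPoint_AB (by unfold InAB at hj; omega),
      chainPoint_AB hj, chainPoint_C hl]
    exact curveAB_own_C (rangeAB_paramAB (lt_trans hij hj)) (rangeAB_paramAB hj)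
      (paramAB_lt hij hj) (rangeC_paramC hl l.2)
  case line_AB_rest =>
    intro t i j l hij hj
    rw [isLeft_ofTriCoord, turn_add, triArea_turn, chainPoint_AB (by unfold InAB at hj; omega),
      chainPoint_AB hj]
    have ri := rangeAB_paramAB (lt_trans hij hj)
    have rj := rangeAB_paramAB hj
    rcases lt_or_ge (l : ℕ) (3 * m) with hl | hl
    · rw [chainPoint_AB hl]
      exact curveAB_rest_AB ri rj (paramAB_lt hij hj) (rangeAB_paramAB hl)
    · rw [chainPoint_C hl]
      exact curveAB_rest_C ri rj (paramAB_lt hij hj) (rangeC_paramC hl l.2)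
  case line_C_separates =>
    intro t i j hi hij
    have hi' : 3 * m ≤ (i : ℕ) := hi
    have hj' : 3 * m ≤ (j : ℕ) := hi'.trans hij.le
    have ri := rangeC_paramC hi' i.2
    have rj := rangeC_paramC hj' j.2
    have hlt := paramC_lt (m := m) (by have := i.2; omega) (Fin.lt_def.1 hij)
    refine ⟨fun l hl => ?_, fun l hl => ?_⟩
    · rw [isLeft_ofTriCoord, triArea_turn, chainPoint_C hi', chainPoint_C hj',
        chainPoint_AB (by unfold InA at hl; omega)]
      exact curveC_A ri rj hlt (rangeA_paramAB hl)
    · rw [isRight_ofTriCoord, triArea_turn, chainPoint_C hi', chainPoint_C hj',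
        chainPoint_AB hl.2]
      exact curveC_B ri rj hlt (rangeB_paramAB hl.1 hl.2)
  case line_CC_separates =>
    intro t i j hi hj
    have ri := rangeC_paramC hi i.2
    have rj := rangeC_paramC hj j.2
    refine ⟨fun l hl => ?_, fun l hl => ?_⟩
    · rw [isLeft_ofTriCoord, turn_add, triArea_turn, chainPoint_C hi, chainPoint_C hj,
        chainPoint_AB (by unfold InA at hl; omega)]
      exact curveC_C_A ri rj (rangeA_paramAB hl)
    · rw [isRight_ofTriCoord, turn_add, triArea_turn, chainPoint_C hi, chainPoint_C hj,
        chainPoint_AB hl.2]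
      exact curveC_C_B ri rj (rangeB_paramAB hl.1 hl.2)
  case line_C_C =>
    intro t s i j l hst hi hij hl
    have hi' : 3 * m ≤ (i : ℕ) := hi
    have hj' : 3 * m ≤ (j : ℕ) := hi'.trans hij.le
    have ri := rangeC_paramC hi' i.2
    have rj := rangeC_paramC hj' j.2
    have rl := rangeC_paramC hl l.2
    have hlt := paramC_lt (m := m) (by have := i.2; omega) (Fin.lt_def.1 hij)
    rcases Fin.cases_add_three t s with rfl | rfl | rfl
    · exact absurd rfl hst
    · rw [isRight_ofTriCoord, turn_add, triArea_turn, chainPoint_C hi', chainPoint_C hj',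
        chainPoint_C hl]
      exact curveC_next ri rj hlt rl
    · rw [isRight_ofTriCoord, turn_add, triArea_turn, chainPoint_C hi', chainPoint_C hj',
        chainPoint_C hl]
      exact curveC_rest ri rj hlt rl
  case triangle_B =>
    intro t s b i hb hi
    -- Writing chain `s` relative to `t` lets the common rotation cancel.
    have hs : s = t + (s - t) := by abel
    rw [hs, isLeft_ofTriCoord, turn_add, turn_add, triArea_turn, chainPoint_AB (by omega),
      chainPoint_C hi]
    exact curveAB_triangle (rangeB_paramAB (by have := i.2; omega) (by omega))
      (rangeC_paramC hi i.2) _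

theorem theorem5 (n m : ℕ) (hm : 0 < m) (hn : n = 12 * m) :
    (∃ (o : Plane) (P : Fin 3 → Fin (4 * m) → Plane), IsThreeChainConfig m o P) ∧
    ∀ (o : Plane) (P : Fin 3 → Fin (4 * m) → Plane), IsThreeChainConfig m o P →
      (pointSet P).card = n ∧
      ∀ k : ℕ, n / 3 ≤ k → k ≤ 5 * n / 12 - 1 →
        numLeEdges (pointSet P) k
          = 3 * (k + 2).choose 2 + 3 * (k - n / 3 + 2).choose 2 ∧
        (numLeEdges (pointSet P) k : ℤ)
          = 3 * ((k + 2).choose 2 : ℤ) + ∑ j ∈ Finset.Icc (n / 3) k, (3 * (j : ℤ) - n + 3) := by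
  refine ⟨exists_isThreeChainConfig m, fun o P h => ⟨by rw [h.card_pointSet, hn], ?_⟩⟩
  intro k hk hk2
  have hn3 : n / 3 = 4 * m := by omega
  rw [hn3] at hk ⊢
  -- As m is positive, the truncated subtraction in the bound on `k` is harmless and gives `k < 5 *
  -- m`.
  have key := h.numLeEdges_pointSet hk (by omega)
  refine ⟨key, ?_⟩
  obtain ⟨x, rfl⟩ := Nat.exists_eq_add_of_le hk
  have hs := sum_Icc_three_mul (4 * m) x
  have hn' : (n : ℤ) = 3 * ((4 * m : ℕ) : ℤ) := by rw [hn]; push_cast; ring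
  rw [key, hn', hs, Nat.add_sub_cancel_left]
  push_cast
  ring
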